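/- Let $d\in\mathbb N$ and let $\mathrm P(\mathbb C^d)$ be the projective space of $\mathbb C^d$; for $\hat x\in\mathrm P(\mathbb C^d)$ let $x$ be a norm-one representative of $\hat x$ and $\pi_{\hat x}$ the orthogonal projector onto $\mathbb C x$. Equip $\mathrm P(\mathbb C^d)$ with the metric $d(\hat x,\hat y)=\|\pi_{\hat x}-\pi_{\hat y}\|$ (operator norm) and its Borel $\sigma$-algebra. For $v\in M_d(\mathbb C)$ with $vx\neq 0$ let $v\cdot\hat x$ be the class of $vx$. Let $\mu$ be a ($\sigma$-finite, Borel) measure on $M_d(\mathbb C)$ with $$\int_{M_d(\mathbb C)}\|v\|^2\,\mathrm d\mu(v)<\infty,\qquad \int_{M_d(\mathbb C)}v^*v\,\mathrm d\mu(v)=\mathrm{Id}_{\mathbb C^d},$$ and let $\Pi$ be the transition kernel on $\mathrm P(\mathbb C^d)$ given by $$\Pi(\hat x,S)=\int_{M_d(\mathbb C)}\mathbf 1_S(v\cdot\hat x)\,\|vx\|^2\,\mathrm d\mu(v),\qquad S\subset \mathrm P(\mathbb C^d)\text{ Borel}.$$ (The value given to $v\cdot\hat x$ when $vx=0$ is irrelevant.)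 Assume: * **(Pur)** Every nonzero orthogonal projector $\pi$ such that, for every $n\in\mathbb N$, for $\mu^{\otimes n}$-almost all $(v_1,\dots,v_n)$ there is a scalar $c\in\mathbb C$ (possibly $0$) with $\pi v_1^*\cdots v_n^*v_n\cdots v_1\pi=c\,\pi$, has rank one. * **(Erg)** Among the subspaces $E\neq\{0\}$ of $\mathbb C^d$ such that $vE\subset E$ for all $v\in\operatorname{supp}\mu$, there is a unique minimal one. Then every continuous function $f:\mathrm P(\mathbb C^d)\to\mathbb C$ that is harmonic for $\Pi$, i.e. such that $$\Pi f(\hat x)=\int_{\mathrm P(\mathbb C^d)} f(\hat y)\,\Pi(\hat x,\mathrm d\hat y)=f(\hat x)\quad\text{for all }\hat x\in \mathrm P(\mathbb C^d),$$ is constant. -/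

import Mathlib

open MeasureTheory ProbabilityTheory
open scoped LinearAlgebra.Projectivization ENNReal

noncomputable section

namespace QuantumTrajectory

/-- The Hilbert space `ℂ^d`. -/
abbrev Hil (d : ℕ) : Type := EuclideanSpace ℂ (Fin d)

/-- `M_d(ℂ)`, as the space of linear operators on `ℂ^d`: `star` is the adjoint, `*` is the
composition, `‖·‖` is the operator norm, and the measurable structure is the Borel one. -/
abbrev Op (d : ℕ) : Type := Hil d →L[ℂ] Hil d

/-- The projective space of `ℂ^d`. -/
abbrev Proj (d : ℕ) : Type := ℙ ℂ (Hil d)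

variable {d : ℕ}

/-- The orthogonal projector `π_x̂` onto the line `x̂`. -/
def lineProj (x : Proj d) : Op d := x.submodule.starProjection

theorem lineProj_injective : Function.Injective (lineProj : Proj d → Op d) := by
  intro x y h
  apply Projectivization.submodule_injective
  have h2 := congrArg (fun T : Op d => LinearMap.range T.toLinearMap) h
  simpa [lineProj, Submodule.range_starProjection] using h2

/-- The metric `d(x̂, ŷ) = ‖π_x̂ - π_ŷ‖` on the projective space. -/
instance instMetricSpaceProj : MetricSpace (Proj d) :=
  MetricSpace.induced lineProj lineProj_injective inferInstance

instance instMeasurableSpaceProj : MeasurableSpace (Proj d) := borel (Proj d)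

instance instBorelSpaceProj : BorelSpace (Proj d) := ⟨rfl⟩

/-- A norm one representative of `x̂`. -/
def unitRep (x : Proj d) : Hil d := ((‖x.rep‖⁻¹ : ℝ) : ℂ) • x.rep

theorem norm_unitRep (x : Proj d) : ‖unitRep x‖ = 1 := by
  have h : ‖x.rep‖ ≠ 0 := norm_ne_zero_iff.mpr x.rep_nonzero
  rw [unitRep, norm_smul, Complex.norm_real, norm_inv, norm_norm, inv_mul_cancel₀ h]

theorem unitRep_ne_zero (x : Proj d) : unitRep x ≠ 0 := by
  rw [← norm_ne_zero_iff, norm_unitRep]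
  exact one_ne_zero

theorem mk_unitRep (x : Proj d) :
    Projectivization.mk ℂ (unitRep x) (unitRep_ne_zero x) = x := by
  conv_rhs => rw [← x.mk_rep]
  exact (Projectivization.mk_eq_mk_iff' ℂ _ _ _ _).mpr ⟨_, rfl⟩

open Classical in
/-- `v · x̂`, the class of `v x`. When `v x = 0` the value is irrelevant, and is taken to
be `x̂`. -/
def act (v : Op d) (x : Proj d) : Proj d :=
  if h : v (unitRep x) ≠ 0 then Projectivization.mk ℂ (v (unitRep x)) h else x

theorem lineProj_mk (w : Hil d) (hw : w ≠ 0) :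
    lineProj (Projectivization.mk ℂ w hw) =
      (((‖w‖ ^ 2)⁻¹ : ℝ) : ℂ) • InnerProductSpace.rankOne ℂ w w := by
  ext1 z
  simp only [lineProj, Projectivization.submodule_mk, _root_.smul_apply,
    InnerProductSpace.rankOne_apply, Submodule.starProjection_singleton, smul_smul]
  congr 1
  push_cast
  rw [div_eq_inv_mul]
  rfl

theorem lineProj_eq (x : Proj d) :
    lineProj x = InnerProductSpace.rankOne ℂ (unitRep x) (unitRep x) := by
  have h := lineProj_mk (unitRep x) (unitRep_ne_zero x)
  rw [mk_unitRep, norm_unitRep] at h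
  simpa using h

theorem mul_lineProj (v : Op d) (x : Proj d) :
    v * lineProj x = InnerProductSpace.rankOne ℂ (v (unitRep x)) (unitRep x) := by
  rw [lineProj_eq]
  ext1 z
  simp [InnerProductSpace.rankOne_apply]

theorem norm_mul_lineProj (v : Op d) (x : Proj d) :
    ‖v * lineProj x‖ = ‖v (unitRep x)‖ := by
  rw [mul_lineProj, InnerProductSpace.norm_rankOne, norm_unitRep, mul_one]

open Classical in
theorem lineProj_act (v : Op d) (x : Proj d) :
    lineProj (act v x) = if ‖v * lineProj x‖ = 0 then lineProj x else
      (((‖v * lineProj x‖ ^ 2)⁻¹ : ℝ) : ℂ) • (v * lineProj x * star v) := by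
  have hz : ‖v * lineProj x‖ = 0 ↔ v (unitRep x) = 0 := by
    rw [norm_mul_lineProj, norm_eq_zero]
  by_cases h : v (unitRep x) = 0
  · rw [if_pos (hz.mpr h), act, dif_neg (not_not.mpr h)]
  · rw [if_neg (fun h' => h (hz.mp h')), act, dif_pos h, lineProj_mk, norm_mul_lineProj,
      mul_lineProj]
    congr 1
    ext1 z
    simp [InnerProductSpace.rankOne_apply, ContinuousLinearMap.star_eq_adjoint,
      ContinuousLinearMap.adjoint_inner_right]

theorem isometry_lineProj : Isometry (lineProj : Proj d → Op d) :=
  Isometry.of_dist_eq fun _ _ => rfl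

theorem measurable_lineProj : Measurable (lineProj : Proj d → Op d) :=
  isometry_lineProj.continuous.measurable

theorem measurable_of_lineProj {α : Type*} [MeasurableSpace α] {F : α → Proj d}
    (h : Measurable fun a => lineProj (F a)) : Measurable F := by
  refine measurable_of_isOpen fun U hU => ?_
  obtain ⟨V, hV, rfl⟩ := isometry_lineProj.isEmbedding.isInducing.isOpen_iff.mp hU
  exact h hV.measurableSet

instance instSecondCountableOp : SecondCountableTopology (Op d) :=
  haveI : ProperSpace (Op d) := FiniteDimensional.proper ℂ (Op d)
  inferInstance

theorem measurable_mul_lineProj :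
    Measurable fun p : Proj d × Op d => p.2 * lineProj p.1 :=
  measurable_snd.mul (measurable_lineProj.comp measurable_fst)

theorem measurable_act : Measurable fun p : Proj d × Op d => act p.2 p.1 := by
  classical
  refine measurable_of_lineProj ?_
  simp_rw [lineProj_act]
  have hm := measurable_mul_lineProj (d := d)
  refine Measurable.ite (hm.norm (measurableSet_singleton (0 : ℝ)))
    (measurable_lineProj.comp measurable_fst) ?_
  refine Measurable.smul (Complex.measurable_ofReal.comp (hm.norm.pow_const 2).inv) ?_
  exact hm.mul
    ((ContinuousLinearMap.adjoint (𝕜 := ℂ) (E := Hil d) (F := Hil d)).continuous.measurable.comp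
      measurable_snd)

theorem measurable_enorm_apply :
    Measurable fun p : Proj d × Op d => ‖p.2 (unitRep p.1)‖ₑ ^ 2 := by
  have h : (fun p : Proj d × Op d => ‖p.2 (unitRep p.1)‖ₑ ^ 2) =
      fun p => ‖p.2 * lineProj p.1‖ₑ ^ 2 := by
    funext p
    rw [← ofReal_norm, ← ofReal_norm, norm_mul_lineProj]
  rw [h]
  exact measurable_mul_lineProj.enorm.pow_const 2

theorem transition_apply (μ : Measure (Op d)) (x : Proj d) {S : Set (Proj d)}
    (hS : MeasurableSet S) :
    (μ.withDensity fun v => ‖v (unitRep x)‖ₑ ^ 2).map (fun v => act v x) S =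
      ∫⁻ v, S.indicator 1 (act v x) * ‖v (unitRep x)‖ₑ ^ 2 ∂μ := by
  have ha : Measurable fun v : Op d => act v x := measurable_act.comp measurable_prodMk_left
  rw [Measure.map_apply ha hS, withDensity_apply _ (ha hS), ← lintegral_indicator (ha hS)]
  refine lintegral_congr fun v => ?_
  by_cases h : act v x ∈ S <;> simp [h]

/-- The transition kernel `Π(x̂, S) = ∫ 1_S(v · x̂) ‖v x‖² dμ(v)`. -/
def transitionKernel (μ : Measure (Op d)) [SFinite μ] : Kernel (Proj d) (Proj d) where
  toFun x := (μ.withDensity fun v => ‖v (unitRep x)‖ₑ ^ 2).map fun v => act v x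
  measurable' := by
    refine Measure.measurable_of_measurable_coe _ fun S hS => ?_
    simp_rw [transition_apply μ _ hS]
    refine Measurable.lintegral_prod_right' (f := fun p : Proj d × Op d =>
      S.indicator (1 : Proj d → ℝ≥0∞) (act p.2 p.1) * ‖p.2 (unitRep p.1)‖ₑ ^ 2) ?_
    have h1 : Measurable (S.indicator (1 : Proj d → ℝ≥0∞)) := measurable_one.indicator hS
    exact (h1.comp measurable_act).mul measurable_enorm_apply

theorem transitionKernel_apply (μ : Measure (Op d)) [SFinite μ] (x : Proj d)
    {S : Set (Proj d)} (hS : MeasurableSet S) :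
    transitionKernel μ x S =
      ∫⁻ v, S.indicator (1 : Proj d → ℝ≥0∞) (act v x) * ‖v (unitRep x)‖ₑ ^ 2 ∂μ :=
  transition_apply μ x hS

/-- `f` is harmonic for `Π`: it is measurable and `Π f = f`, where
`Π f (x̂) = ∫ f(ŷ) Π(x̂, dŷ)`. -/
def IsHarmonic (μ : Measure (Op d)) [SFinite μ] (f : Proj d → ℂ) : Prop :=
  Measurable f ∧ ∀ x, ∫ y, f y ∂(transitionKernel μ x) = f x

/-- The product `v_n ⋯ v_1` (with `v 0 = v_1`, …, `v (n - 1) = v_n`). -/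
def prodOp {n : ℕ} (v : Fin n → Op d) : Op d := (List.ofFn v).reverse.prod

/-- The standing assumptions on `μ`: `∫ ‖v‖² dμ(v) < ∞` and `∫ v* v dμ(v) = Id`. -/
structure IsStochastic (μ : Measure (Op d)) : Prop where
  integrable : Integrable (fun v => ‖v‖ ^ 2) μ
  integral_eq_one : ∫ v, star v * v ∂μ = 1

/-- Assumption **(Pur)**: every nonzero orthogonal projector `π` such that, for all `n`,
`π v_1* ⋯ v_n* v_n ⋯ v_1 π ∝ π` for `μ^{⊗n}`-almost all `(v_1, …, v_n)`, has rank one.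
(The zero projector always satisfies the proportionality.) -/
def Pur (μ : Measure (Op d)) : Prop :=
  ∀ π : Op d, IsStarProjection π → π ≠ 0 →
    (∀ n : ℕ, ∀ᵐ v ∂(Measure.pi fun _ : Fin n => μ),
      ∃ c : ℂ, π * star (prodOp v) * prodOp v * π = c • π) →
    Module.finrank ℂ (LinearMap.range π.toLinearMap) = 1

/-- `E` is a nonzero subspace with `v E ⊆ E` for all `v` in the support of `μ`. -/
def IsInvariantSubspace (μ : Measure (Op d)) (E : Submodule ℂ (Hil d)) : Prop :=
  E ≠ ⊥ ∧ ∀ v ∈ μ.support, ∀ x ∈ E, v x ∈ E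

/-- Assumption **(Erg)**: there is a unique minimal nonzero subspace `E` with `v E ⊆ E` for
all `v` in the support of `μ`. -/
def Erg (μ : Measure (Op d)) : Prop :=
  ∃! E : Submodule ℂ (Hil d), Minimal (IsInvariantSubspace μ) E

end QuantumTrajectory

end

/-! A continuous harmonic `f` is shown to be a quadratic form `x ↦ ⟨x, A x⟩` on unit vectors by
means of (Pur); a maximum principle and (Erg) then make it constant.

Quadratic form. Let `W` be a product of `n` independent factors, with law `prodLaw μ n`. Since `∫ ‖W
x‖² = ‖x‖²`, the mean of `‖W x ∧ W y‖` over an orthonormal pair is at most 1. Equality for every `n`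
would make almost every product conformal on the span of the pair, and the rank-two projector on
that span would contradict (Pur). Compactness and submultiplicativity upgrade this to geometric
decay, uniform over pairs (`exists_meanArea_lt`). The area controls `d(W·x, W·y) ‖W x‖ ‖W y‖`, so in
the mean value formula `f(x) = ∫ ‖W x‖² f(W·x)` the factor `f(W·x)` may be replaced by a number
`c(W)` independent of `x`, with small error. What is left is the form of `∫ c(W) W*W`
(`exists_quadForm_near`). Quadratic forms span a finite-dimensional, hence closed, space, so `f` is
one of them (`exists_eq_quadForm`).

Constancy. If `M` is the maximum of `Re f`, then `M - Re A` is positive semidefinite with nonzero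
kernel, and harmonicity makes this kernel invariant under `supp μ`. By (Erg) it contains the minimal
subspace `E`. The same holds for the minimum `m`, so `Re A` equals both `M` and `m` on `E ≠ 0`, and
`M = m` (`exists_re_eq_const`). The imaginary part is the real part of `-i f`. -/

noncomputable section

namespace QuantumTrajectory

/-! ### Areas of parallelograms in complex inner product spaces -/

section Area

variable {E F : Type*} [NormedAddCommGroup E] [InnerProductSpace ℂ E]
  [NormedAddCommGroup F] [InnerProductSpace ℂ F]

/-- The area of the parallelogram spanned by two vectors, i.e. the norm of `x ∧ y`. -/
def area (x y : E) : ℝ := √(‖x‖ ^ 2 * ‖y‖ ^ 2 - ‖inner ℂ x y‖ ^ 2)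

theorem area_nonneg (x y : E) : 0 ≤ area x y := Real.sqrt_nonneg _

theorem area_sq (x y : E) : area x y ^ 2 = ‖x‖ ^ 2 * ‖y‖ ^ 2 - ‖inner ℂ x y‖ ^ 2 := by
  refine Real.sq_sqrt (sub_nonneg.mpr ?_)
  rw [← mul_pow]
  exact pow_le_pow_left₀ (norm_nonneg _) (norm_inner_le_norm x y) 2

theorem area_le (x y : E) : area x y ≤ ‖x‖ * ‖y‖ := by
  refine abs_le_of_sq_le_sq' ?_ (by positivity) |>.2
  rw [area_sq, mul_pow]
  linarith [sq_nonneg ‖inner ℂ x y‖]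

theorem continuous_area : Continuous fun p : E × E => area p.1 p.2 := by
  unfold area
  fun_prop

theorem area_smul_smul (a b : ℂ) (x y : E) : area (a • x) (b • y) = ‖a‖ * ‖b‖ * area x y := by
  rw [← sq_eq_sq₀ (area_nonneg _ _) (mul_nonneg (by positivity) (area_nonneg _ _)), mul_pow,
    area_sq, area_sq, inner_smul_left, inner_smul_right]
  simp only [norm_smul, norm_mul, RCLike.norm_conj]
  ring

theorem area_zero_left (y : E) : area 0 y = 0 := by simp [area]

theorem area_zero_right (x : E) : area x 0 = 0 := by simp [area]

theorem norm_sub_smul_sq (x y : E) (hx : ‖x‖ = 1) :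
    ‖y - (inner ℂ x y) • x‖ ^ 2 = ‖y‖ ^ 2 - ‖inner ℂ x y‖ ^ 2 := by
  have h : inner ℂ (y - (inner ℂ x y) • x) ((inner ℂ x y) • x) = 0 := by
    rw [inner_smul_right, inner_sub_left, inner_smul_left, inner_self_eq_norm_sq_to_K, hx,
      inner_conj_symm]
    simp
  have h2 := norm_add_sq_eq_norm_sq_add_norm_sq_of_inner_eq_zero _ _ h
  rw [sub_add_cancel, norm_smul, hx, mul_one] at h2
  linarith

theorem area_of_unit_left (x y : E) (hx : ‖x‖ = 1) :
    area x y = ‖y - (inner ℂ x y) • x‖ := by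
  rw [← sq_eq_sq₀ (area_nonneg _ _) (norm_nonneg _), area_sq, norm_sub_smul_sq x y hx, hx]
  ring

/-- Shear invariance of `x ∧ y`: for unit `x` the area is the distance from `y` to the line of `x`,
and the general case follows by scaling. -/
theorem area_add_smul (c : ℂ) (x y : E) : area x (y + c • x) = area x y := by
  by_cases hx : x = 0
  · simp [hx, area_zero_left]
  have hn : (‖x‖ : ℂ) ≠ 0 := by simpa using hx
  set e : E := ((‖x‖ : ℂ)⁻¹) • x with he
  have he1 : ‖e‖ = 1 := by
    rw [he, norm_smul, norm_inv, Complex.norm_real, norm_norm,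
      inv_mul_cancel₀ (norm_ne_zero_iff.mpr hx)]
  have hxe : x = (‖x‖ : ℂ) • e := by rw [he, smul_smul, mul_inv_cancel₀ hn, one_smul]
  have key : ∀ (b : ℂ), area e (y + b • e) = area e y := by
    intro b
    rw [area_of_unit_left _ _ he1, area_of_unit_left _ _ he1, inner_add_right, inner_smul_right,
      inner_self_eq_norm_sq_to_K, he1]
    congr 1
    simp only [RCLike.ofReal_one, one_pow, mul_one]
    module
  have h1 : ∀ z : E, area x z = ‖x‖ * area e z := by
    intro z
    have := area_smul_smul (‖x‖ : ℂ) 1 e z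
    rw [← hxe] at this
    simpa using this
  rw [h1, h1]
  congr 1
  conv_lhs => rw [hxe, smul_smul]
  exact key _

theorem area_comm (x y : E) : area x y = area y x := by
  rw [area, area, mul_comm, norm_inner_symm]

/-- Orthonormal pairs of vectors. -/
def orthoPairs (E : Type*) [NormedAddCommGroup E] [InnerProductSpace ℂ E] : Set (E × E) :=
  {p | ‖p.1‖ = 1 ∧ ‖p.2‖ = 1 ∧ inner ℂ p.1 p.2 = 0}

theorem area_of_mem_orthoPairs {p : E × E} (hp : p ∈ orthoPairs E) : area p.1 p.2 = 1 := by
  rw [area, hp.1, hp.2.1, hp.2.2]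
  simp

theorem isCompact_orthoPairs [ProperSpace E] : IsCompact (orthoPairs E) := by
  have h1 : IsClosed (orthoPairs E) := by
    have : orthoPairs E = {p | ‖p.1‖ = 1} ∩ ({p | ‖p.2‖ = 1} ∩ {p | inner ℂ p.1 p.2 = 0}) := rfl
    rw [this]
    refine IsClosed.inter ?_ (IsClosed.inter ?_ ?_)
    · exact isClosed_eq (by fun_prop) (by fun_prop)
    · exact isClosed_eq (by fun_prop) (by fun_prop)
    · exact isClosed_eq (by fun_prop) (by fun_prop)
  refine ((isCompact_sphere (0 : E) 1).prod (isCompact_sphere (0 : E) 1)).of_isClosed_subset h1 ?_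
  intro p hp
  simp [hp.1, hp.2.1]

/-- Gram–Schmidt: `x ∧ y` is a multiple of `p.1 ∧ p.2`, with one orthonormal pair serving every `W`.
Mean area estimates therefore need only be proved on orthonormal pairs, which form a compact set. -/
theorem area_map_eq_zero_or (x y : E) :
    (∀ W : E →L[ℂ] F, area (W x) (W y) = 0) ∨
      ∃ p ∈ orthoPairs E, ∀ W : E →L[ℂ] F,
        area (W x) (W y) = area x y * area (W p.1) (W p.2) := by
  by_cases hx : x = 0
  · left
    intro W
    rw [hx, map_zero, area_zero_left]
  set c : ℂ := inner ℂ x y / (‖x‖ : ℂ) ^ 2 with hc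
  set z : E := y - c • x with hz
  have hnx : (‖x‖ : ℂ) ≠ 0 := by simpa using hx
  have hy : y = z + c • x := by rw [hz]; abel
  have hxz : inner ℂ x z = 0 := by
    rw [hz, inner_sub_right, inner_smul_right, inner_self_eq_norm_sq_to_K, hc]
    simp [hnx]
  by_cases hz0 : z = 0
  · left
    intro W
    rw [hy, map_add, map_smul, area_add_smul, hz0, map_zero, area_zero_right]
  right
  have hnz : (‖z‖ : ℂ) ≠ 0 := by simpa using hz0
  refine ⟨((‖x‖ : ℂ)⁻¹ • x, (‖z‖ : ℂ)⁻¹ • z), ⟨?_, ?_, ?_⟩, fun W => ?_⟩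
  · simp [norm_smul, hx]
  · simp [norm_smul, hz0]
  · simp [hxz]
  · have h1 : area x y = ‖x‖ * ‖z‖ := by
      rw [hy, area_add_smul, area, hxz]
      simp [← mul_pow, Real.sqrt_sq (mul_nonneg (norm_nonneg x) (norm_nonneg z))]
    rw [h1]
    conv_lhs => rw [hy, map_add, map_smul, area_add_smul]
    simp only [map_smul, area_smul_smul, norm_inv, Complex.norm_real, norm_norm]
    have : ‖x‖ ≠ 0 := norm_ne_zero_iff.mpr hx
    have : ‖z‖ ≠ 0 := norm_ne_zero_iff.mpr hz0
    field_simp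

theorem norm_rankOne_sub_rankOne_le (a b : E) (ha : ‖a‖ = 1) (hb : ‖b‖ = 1) :
    ‖InnerProductSpace.rankOne ℂ a a - InnerProductSpace.rankOne ℂ b b‖ ≤ 2 * area a b := by
  have h : InnerProductSpace.rankOne ℂ a a - InnerProductSpace.rankOne ℂ b b =
      InnerProductSpace.rankOne ℂ (a - (inner ℂ b a) • b) a -
        InnerProductSpace.rankOne ℂ b (b - (inner ℂ a b) • a) := by
    ext1 z
    simp only [_root_.sub_apply, InnerProductSpace.rankOne_apply, inner_sub_left,
      inner_smul_left, inner_conj_symm]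
    module
  rw [h]
  refine (norm_sub_le _ _).trans ?_
  rw [InnerProductSpace.norm_rankOne, InnerProductSpace.norm_rankOne, ha, hb,
    ← area_of_unit_left b a hb, ← area_of_unit_left a b ha, area_comm b a]
  linarith

/-- If the area equals the arithmetic mean of the squared norms, then the two vectors are
orthogonal and of the same length. -/
theorem eq_of_area_eq {x y : E} (h : area x y = (‖x‖ ^ 2 + ‖y‖ ^ 2) / 2) :
    inner ℂ x y = 0 ∧ ‖x‖ = ‖y‖ := by
  have h1 := area_sq x y
  rw [h] at h1
  have h2 : (‖x‖ ^ 2 - ‖y‖ ^ 2) ^ 2 / 4 + ‖inner ℂ x y‖ ^ 2 = 0 := by linarith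
  have h3 : ‖inner ℂ x y‖ ^ 2 = 0 := by
    have := sq_nonneg (‖x‖ ^ 2 - ‖y‖ ^ 2)
    have := sq_nonneg ‖inner ℂ x y‖
    linarith
  refine ⟨by simpa using h3, ?_⟩
  rw [h3] at h2
  have h4 : ‖x‖ ^ 2 - ‖y‖ ^ 2 = 0 := by
    rw [← sq_eq_zero_iff]
    linarith
  exact (sq_eq_sq₀ (norm_nonneg _) (norm_nonneg _)).mp (sub_eq_zero.mp h4)

theorem area_le_half (x y : E) : area x y ≤ (‖x‖ ^ 2 + ‖y‖ ^ 2) / 2 := by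
  have := area_le x y
  have := two_mul_le_add_sq ‖x‖ ‖y‖
  linarith

end Area

/-! ### The action on projective space, its cocycle, and compactness -/

variable {d : ℕ}

theorem norm_apply_unitRep_mk (W : Op d) (w : Hil d) (hw : w ≠ 0) :
    ‖w‖ * ‖W (unitRep (Projectivization.mk ℂ w hw))‖ = ‖W w‖ := by
  have h := norm_mul_lineProj W (Projectivization.mk ℂ w hw)
  rw [← h, lineProj_mk]
  have h2 : W * ((((‖w‖ ^ 2)⁻¹ : ℝ) : ℂ) • InnerProductSpace.rankOne ℂ w w) =
      (((‖w‖ ^ 2)⁻¹ : ℝ) : ℂ) • InnerProductSpace.rankOne ℂ (W w) w := by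
    ext1 z
    simp [InnerProductSpace.rankOne_apply]
  have hn : ‖w‖ ≠ 0 := norm_ne_zero_iff.mpr hw
  rw [h2, norm_smul, InnerProductSpace.norm_rankOne, Complex.norm_real, Real.norm_of_nonneg
    (by positivity)]
  field_simp

/-- The cocycle identity for the weights. It survives `v x = 0`, whatever value `act` takes there,
because both sides vanish. -/
theorem norm_mul_apply_unitRep (W v : Op d) (x : Proj d) :
    ‖(W * v) (unitRep x)‖ = ‖v (unitRep x)‖ * ‖W (unitRep (act v x))‖ := by
  by_cases h : v (unitRep x) = 0
  · simp [h]
  · rw [act, dif_pos h, norm_apply_unitRep_mk]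
    rfl

theorem act_mul (W v : Op d) (x : Proj d) (h : v (unitRep x) ≠ 0)
    (h2 : (W * v) (unitRep x) ≠ 0) : act (W * v) x = act W (act v x) := by
  have h3 : ‖W (unitRep (act v x))‖ ≠ 0 := by
    intro h0
    apply h2
    rw [← norm_eq_zero, norm_mul_apply_unitRep, h0, mul_zero]
  have h3' : W (unitRep (act v x)) ≠ 0 := norm_ne_zero_iff.mp h3
  obtain ⟨c, hc⟩ := (Projectivization.mk_eq_mk_iff' ℂ _ _ (unitRep_ne_zero (act v x)) h).mp (by
    rw [mk_unitRep, act, dif_pos h])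
  rw [act, dif_pos h2, act, dif_pos h3', Projectivization.mk_eq_mk_iff']
  have hc0 : c ≠ 0 := by
    rintro rfl
    exact unitRep_ne_zero _ (by rw [← hc, zero_smul])
  refine ⟨c⁻¹, ?_⟩
  rw [← hc, map_smul, smul_smul, inv_mul_cancel₀ hc0, one_smul]
  rfl

theorem dist_mk_mul_le (p q : Hil d) (hp : p ≠ 0) (hq : q ≠ 0) :
    dist (Projectivization.mk ℂ p hp) (Projectivization.mk ℂ q hq) * (‖p‖ * ‖q‖) ≤
      2 * area p q := by
  have hnp : ‖p‖ ≠ 0 := norm_ne_zero_iff.mpr hp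
  have hnq : ‖q‖ ≠ 0 := norm_ne_zero_iff.mpr hq
  have key : ∀ (w : Hil d) (hw : w ≠ 0), lineProj (Projectivization.mk ℂ w hw) =
      InnerProductSpace.rankOne ℂ ((‖w‖ : ℂ)⁻¹ • w) ((‖w‖ : ℂ)⁻¹ • w) := by
    intro w hw
    rw [lineProj_mk]
    ext1 z
    simp only [_root_.smul_apply, InnerProductSpace.rankOne_apply, inner_smul_left, smul_smul]
    congr 1
    simp
    ring
  have h1 := norm_rankOne_sub_rankOne_le ((‖p‖ : ℂ)⁻¹ • p) ((‖q‖ : ℂ)⁻¹ • q)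
    (by simp [norm_smul, hnp]) (by simp [norm_smul, hnq])
  rw [← key p hp, ← key q hq, area_smul_smul, ← dist_eq_norm, isometry_lineProj.dist_eq] at h1
  simp only [norm_inv, Complex.norm_real, norm_norm] at h1
  calc _ ≤ 2 * (‖p‖⁻¹ * ‖q‖⁻¹ * area p q) * (‖p‖ * ‖q‖) :=
        mul_le_mul_of_nonneg_right h1 (by positivity)
    _ = 2 * area p q := by field_simp

/-- The link between the projective metric and the area. Keeping the norms as factors on the left
makes the arbitrary values of `act` harmless. -/
theorem dist_act_mul_le (W : Op d) (x y : Proj d) :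
    dist (act W x) (act W y) * (‖W (unitRep x)‖ * ‖W (unitRep y)‖) ≤
      2 * area (W (unitRep x)) (W (unitRep y)) := by
  by_cases hx : W (unitRep x) = 0
  · simp [hx, area_nonneg]
  by_cases hy : W (unitRep y) = 0
  · simp [hy, area_nonneg]
  rw [act, dif_pos hx, act, dif_pos hy]
  exact dist_mk_mul_le _ _ hx hy

/-- `lineProj` is an isometric embedding whose range is the continuous image of the unit sphere
under `u ↦ |u⟩⟨u|`. -/
instance instCompactSpaceProj : CompactSpace (Proj d) := by
  have h : Set.range (lineProj : Proj d → Op d) =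
      (fun u : Hil d => (InnerProductSpace.rankOne ℂ u u : Op d)) '' Metric.sphere 0 1 := by
    ext T
    constructor
    · rintro ⟨x, rfl⟩
      exact ⟨unitRep x, by simp [norm_unitRep], (lineProj_eq x).symm⟩
    · rintro ⟨u, hu, rfl⟩
      have hu1 : ‖u‖ = 1 := by simpa using hu
      have hu0 : u ≠ 0 := by
        rintro rfl
        simp at hu1
      exact ⟨Projectivization.mk ℂ u hu0, by simp [lineProj_mk, hu1]⟩
  have hc : IsCompact (Set.range (lineProj : Proj d → Op d)) := by
    rw [h]
    refine (isCompact_sphere (0 : Hil d) 1).image ?_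
    refine continuous_clm_apply.mpr fun z => ?_
    simp only [InnerProductSpace.rankOne_apply]
    fun_prop
  exact isCompact_univ_iff.mp
    (isometry_lineProj.isEmbedding.isCompact_iff.mpr (by rwa [Set.image_univ]))

/-! ### Laws of products of independent operators -/

section ProdLaw

theorem prodOp_succ {n : ℕ} (v : Fin (n + 1) → Op d) :
    prodOp v = prodOp (fun i => v i.succ) * v 0 := by
  simp [prodOp, List.ofFn_succ]

theorem measurable_prodOp : ∀ n : ℕ, Measurable (prodOp : (Fin n → Op d) → Op d)
  | 0 => measurable_const (a := (1 : Op d))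
  | n + 1 => by
    have h : (prodOp : (Fin (n + 1) → Op d) → Op d) =
        fun v => prodOp (fun i => v i.succ) * v 0 := funext prodOp_succ
    rw [h]
    refine Measurable.mul ((measurable_prodOp n).comp ?_) (measurable_pi_apply 0)
    exact measurable_pi_lambda _ fun i => measurable_pi_apply _

/-- The image of `μ^{⊗n}` under `(v_1, …, v_n) ↦ v_n ⋯ v_1`. -/
def prodLaw (μ : Measure (Op d)) (n : ℕ) : Measure (Op d) :=
  (Measure.pi fun _ : Fin n => μ).map prodOp

instance (μ : Measure (Op d)) [SigmaFinite μ] (n : ℕ) : SFinite (prodLaw μ n) := by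
  unfold prodLaw
  infer_instance

theorem prodLaw_zero (μ : Measure (Op d)) [SigmaFinite μ] : prodLaw μ 0 = Measure.dirac 1 := by
  rw [prodLaw, Measure.pi_of_empty, Measure.map_dirac' (measurable_prodOp 0)]
  rfl

/-- The factor split off is `v_1`, which acts first and so stands on the right of the product. -/
theorem prodLaw_succ (μ : Measure (Op d)) [SigmaFinite μ] (n : ℕ) :
    prodLaw μ (n + 1) = (prodLaw μ n).mconv μ := by
  have h := (measurePreserving_piFinSuccAbove (fun _ : Fin (n + 1) => μ) 0).map_eq
  have h2 : (prodLaw μ n).mconv μ =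
      ((μ.prod (Measure.pi fun _ : Fin n => μ)).map
        fun p : Op d × (Fin n → Op d) => prodOp p.2 * p.1) := by
    have h3 : (prodLaw μ n).prod μ =
        ((Measure.pi fun _ : Fin n => μ).prod μ).map (Prod.map prodOp id) := by
      have := Measure.map_prod_map (Measure.pi fun _ : Fin n => μ) μ
        (measurable_prodOp n) measurable_id
      rwa [Measure.map_id] at this
    rw [Measure.mconv, h3, Measure.map_map measurable_mul
      ((measurable_prodOp n).prodMap measurable_id), ← Measure.prod_swap (μ := μ),
      Measure.map_map (measurable_mul.comp ((measurable_prodOp n).prodMap measurable_id))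
        measurable_swap]
    rfl
  have hm : Measurable fun p : Op d × (Fin n → Op d) => prodOp p.2 * p.1 :=
    ((measurable_prodOp n).comp measurable_snd).mul measurable_fst
  rw [h2, ← h, Measure.map_map hm (MeasurableEquiv.measurable _), prodLaw]
  congr 1
  funext v
  rw [prodOp_succ]
  rfl

theorem prodLaw_add (μ : Measure (Op d)) [SigmaFinite μ] (m n : ℕ) :
    prodLaw μ (m + n) = (prodLaw μ m).mconv (prodLaw μ n) := by
  induction n with
  | zero => rw [prodLaw_zero, Measure.mconv_dirac_one, add_zero]
  | succ n ih => rw [← add_assoc, prodLaw_succ, prodLaw_succ, ih, Measure.mconv_assoc]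

/-- In this order the inner integral lets a property of `ν₁` be applied to the vectors `v x` with
`v` fixed. -/
theorem lintegral_mconv_swap (ν₁ ν₂ : Measure (Op d)) [SFinite ν₁] [SFinite ν₂]
    {g : Op d → ℝ≥0∞} (hg : Measurable g) :
    ∫⁻ W, g W ∂(ν₁.mconv ν₂) = ∫⁻ v, ∫⁻ W, g (W * v) ∂ν₁ ∂ν₂ := by
  rw [Measure.lintegral_mconv hg]
  exact lintegral_lintegral_swap (hg.comp measurable_mul).aemeasurable

end ProdLaw

/-! ### Measures that preserve squared norms in mean -/

section MeanIsometric

/-- `∫ ‖W x‖² dν(W) = ‖x‖²` for all `x`. -/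
def IsMeanIsometric (ν : Measure (Op d)) : Prop :=
  ∀ x : Hil d, ∫⁻ W, ‖W x‖ₑ ^ 2 ∂ν = ‖x‖ₑ ^ 2

theorem measurable_enorm_apply_const (x : Hil d) : Measurable fun W : Op d => ‖W x‖ₑ ^ 2 := by
  have : Continuous fun W : Op d => W x := by fun_prop
  exact this.measurable.enorm.pow_const 2

theorem enorm_sq_eq_ofReal {E : Type*} [SeminormedAddCommGroup E] (x : E) :
    ‖x‖ₑ ^ 2 = ENNReal.ofReal (‖x‖ ^ 2) := by
  rw [← ofReal_norm, ENNReal.ofReal_pow (norm_nonneg _)]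

theorem inner_star_mul_self (W : Op d) (x y : Hil d) :
    inner ℂ x ((star W * W) y) = inner ℂ (W x) (W y) := by
  simp [ContinuousLinearMap.star_eq_adjoint, ContinuousLinearMap.adjoint_inner_right]

/-- The linear form `T ↦ ⟨x, T x⟩`. -/
def quadForm (x : Hil d) : Op d →L[ℂ] ℂ :=
  (innerSL ℂ x).comp (ContinuousLinearMap.apply ℂ (Hil d) x)

@[simp]
theorem quadForm_apply (x : Hil d) (T : Op d) : quadForm x T = inner ℂ x (T x) := rfl

theorem quadForm_star_mul_self (x : Hil d) (W : Op d) :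
    quadForm x (star W * W) = ((‖W x‖ ^ 2 : ℝ) : ℂ) := by
  rw [quadForm_apply, inner_star_mul_self, inner_self_eq_norm_sq_to_K]
  push_cast
  rfl

theorem IsStochastic.isMeanIsometric {μ : Measure (Op d)} (hμ : IsStochastic μ) :
    IsMeanIsometric μ := by
  intro x
  have hc : Continuous fun v : Op d => star v * v :=
    (ContinuousLinearMap.adjoint (𝕜 := ℂ) (E := Hil d) (F := Hil d)).continuous.mul continuous_id
  have hi : Integrable (fun v : Op d => star v * v) μ := by
    refine hμ.integrable.mono' hc.aestronglyMeasurable (Filter.Eventually.of_forall fun v => ?_)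
    rw [sq]
    exact (ContinuousLinearMap.norm_adjoint_comp_self v).le
  have h1 := (quadForm x).integral_comp_comm hi
  have h0 := (quadForm x).integrable_comp hi
  simp only [quadForm_star_mul_self] at h1 h0
  rw [hμ.integral_eq_one, integral_complex_ofReal] at h1
  have h2 : ∫ v : Op d, ‖v x‖ ^ 2 ∂μ = ‖x‖ ^ 2 := by
    have : quadForm x (1 : Op d) = ((‖x‖ ^ 2 : ℝ) : ℂ) := by
      rw [quadForm_apply, one_apply_eq_self, inner_self_eq_norm_sq_to_K]
      push_cast
      rfl
    rw [this] at h1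
    exact_mod_cast h1
  have h3 : Integrable (fun v : Op d => ‖v x‖ ^ 2) μ := h0.re
  simp_rw [enorm_sq_eq_ofReal]
  rw [← ofReal_integral_eq_lintegral_ofReal h3 (Filter.Eventually.of_forall fun v => by positivity),
    h2]

theorem IsMeanIsometric.mconv {ν₁ ν₂ : Measure (Op d)} [SFinite ν₁] [SFinite ν₂]
    (h₁ : IsMeanIsometric ν₁) (h₂ : IsMeanIsometric ν₂) : IsMeanIsometric (ν₁.mconv ν₂) := by
  intro x
  rw [lintegral_mconv_swap _ _ (measurable_enorm_apply_const x), ← h₂ x]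
  exact lintegral_congr fun v => h₁ (v x)

theorem isMeanIsometric_dirac_one : IsMeanIsometric (Measure.dirac (1 : Op d)) := by
  intro x
  rw [lintegral_dirac' _ (measurable_enorm_apply_const x)]
  rfl

theorem IsMeanIsometric.prodLaw {μ : Measure (Op d)} [SigmaFinite μ] (hμ : IsMeanIsometric μ)
    (n : ℕ) : IsMeanIsometric (prodLaw μ n) := by
  induction n with
  | zero => rw [prodLaw_zero]; exact isMeanIsometric_dirac_one
  | succ n ih => rw [prodLaw_succ]; exact ih.mconv hμ

variable {ν : Measure (Op d)}

theorem IsMeanIsometric.integrable_norm_apply_sq (h : IsMeanIsometric ν) (x : Hil d) :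
    Integrable (fun W : Op d => ‖W x‖ ^ 2) ν := by
  have hc : Continuous fun W : Op d => ‖W x‖ ^ 2 := by fun_prop
  refine ⟨hc.aestronglyMeasurable, ?_⟩
  rw [hasFiniteIntegral_iff_ofReal (Filter.Eventually.of_forall fun W => by positivity)]
  have := h x
  simp_rw [enorm_sq_eq_ofReal] at this
  rw [this]
  exact ENNReal.ofReal_lt_top

theorem norm_apply_sq_le_sum (W : Op d) (x : Hil d) :
    ‖W x‖ ^ 2 ≤ ‖x‖ ^ 2 * ∑ i, ‖W (EuclideanSpace.basisFun (Fin d) ℂ i)‖ ^ 2 := by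
  set b := EuclideanSpace.basisFun (Fin d) ℂ
  have h1 : ‖W x‖ ≤ ∑ i, ‖inner ℂ (b i) x‖ * ‖W (b i)‖ := by
    conv_lhs => rw [← b.sum_repr' x, map_sum]
    refine (norm_sum_le _ _).trans_eq (Finset.sum_congr rfl fun i _ => ?_)
    rw [map_smul, norm_smul]
  calc ‖W x‖ ^ 2 ≤ (∑ i, ‖inner ℂ (b i) x‖ * ‖W (b i)‖) ^ 2 :=
        pow_le_pow_left₀ (norm_nonneg _) h1 2
    _ ≤ (∑ i, ‖inner ℂ (b i) x‖ ^ 2) * ∑ i, ‖W (b i)‖ ^ 2 :=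
        Finset.sum_mul_sq_le_sq_mul_sq _ _ _
    _ = ‖x‖ ^ 2 * ∑ i, ‖W (b i)‖ ^ 2 := by rw [b.sum_sq_norm_inner_right]

/-- The Hilbert–Schmidt norm dominates the operator norm, so integrability of `‖W‖²` reduces to that
of `‖W e_i‖²`. -/
theorem norm_sq_le_sum (W : Op d) :
    ‖W‖ ^ 2 ≤ ∑ i, ‖W (EuclideanSpace.basisFun (Fin d) ℂ i)‖ ^ 2 := by
  have h : ‖W‖ ≤ √(∑ i, ‖W (EuclideanSpace.basisFun (Fin d) ℂ i)‖ ^ 2) := by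
    refine ContinuousLinearMap.opNorm_le_bound _ (Real.sqrt_nonneg _) fun x => ?_
    refine (le_abs_self _).trans ((Real.abs_le_sqrt (norm_apply_sq_le_sum W x)).trans_eq ?_)
    rw [Real.sqrt_mul (by positivity), Real.sqrt_sq (norm_nonneg _), mul_comm]
  calc ‖W‖ ^ 2 ≤ √(∑ i, ‖W (EuclideanSpace.basisFun (Fin d) ℂ i)‖ ^ 2) ^ 2 :=
        pow_le_pow_left₀ (norm_nonneg _) h 2
    _ = _ := Real.sq_sqrt (by positivity)

theorem IsMeanIsometric.integrable_norm_sq (h : IsMeanIsometric ν) :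
    Integrable (fun W : Op d => ‖W‖ ^ 2) ν := by
  refine Integrable.mono' (integrable_finsetSum Finset.univ fun i _ =>
    h.integrable_norm_apply_sq (EuclideanSpace.basisFun (Fin d) ℂ i))
    (by fun_prop) (Filter.Eventually.of_forall fun W => ?_)
  rw [Real.norm_of_nonneg (by positivity)]
  exact norm_sq_le_sum W

theorem IsMeanIsometric.lintegral_half (h : IsMeanIsometric ν) (x y : Hil d) :
    ∫⁻ W : Op d, ENNReal.ofReal ((‖W x‖ ^ 2 + ‖W y‖ ^ 2) / 2) ∂ν =
      ENNReal.ofReal ((‖x‖ ^ 2 + ‖y‖ ^ 2) / 2) := by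
  have key : ∀ a b : Hil d, ENNReal.ofReal ((‖a‖ ^ 2 + ‖b‖ ^ 2) / 2) =
      (‖a‖ₑ ^ 2 + ‖b‖ₑ ^ 2) / 2 := by
    intro a b
    rw [ENNReal.ofReal_div_of_pos two_pos, ENNReal.ofReal_add (by positivity) (by positivity),
      enorm_sq_eq_ofReal, enorm_sq_eq_ofReal, ENNReal.ofReal_ofNat]
  have hm : Measurable fun W : Op d => ‖W x‖ₑ ^ 2 + ‖W y‖ₑ ^ 2 :=
    (measurable_enorm_apply_const x).add (measurable_enorm_apply_const y)
  simp_rw [key, div_eq_mul_inv]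
  rw [lintegral_mul_const _ hm,
    lintegral_add_left (measurable_enorm_apply_const x), h x, h y]

end MeanIsometric

/-! ### Purification: contraction of the mean area -/

section MeanArea

/-- The mean area of the image of a parallelogram. -/
def meanArea (ν : Measure (Op d)) (p : Hil d × Hil d) : ℝ≥0∞ :=
  ∫⁻ W : Op d, ENNReal.ofReal (area (W p.1) (W p.2)) ∂ν

theorem continuous_area_map (p : Hil d × Hil d) :
    Continuous fun W : Op d => area (W p.1) (W p.2) :=
  continuous_area.comp (f := fun W : Op d => (W p.1, W p.2)) (by fun_prop)

theorem measurable_ofReal_area_map (p : Hil d × Hil d) :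
    Measurable fun W : Op d => ENNReal.ofReal (area (W p.1) (W p.2)) :=
  (continuous_area_map p).measurable.ennreal_ofReal

variable {ν ν₁ ν₂ : Measure (Op d)}

theorem IsMeanIsometric.lintegral_half_orthoPairs (h : IsMeanIsometric ν) {p : Hil d × Hil d}
    (hp : p ∈ orthoPairs (Hil d)) :
    ∫⁻ W : Op d, ENNReal.ofReal ((‖W p.1‖ ^ 2 + ‖W p.2‖ ^ 2) / 2) ∂ν = 1 := by
  rw [h.lintegral_half, hp.1, hp.2.1]
  norm_num

theorem IsMeanIsometric.meanArea_le_one (h : IsMeanIsometric ν) {p : Hil d × Hil d}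
    (hp : p ∈ orthoPairs (Hil d)) : meanArea ν p ≤ 1 := by
  rw [← h.lintegral_half_orthoPairs hp]
  exact lintegral_mono fun W => ENNReal.ofReal_le_ofReal (area_le_half _ _)

theorem meanArea_le_mul {r : ℝ≥0∞} (hr : ∀ p ∈ orthoPairs (Hil d), meanArea ν p ≤ r)
    (p : Hil d × Hil d) : meanArea ν p ≤ r * ENNReal.ofReal (area p.1 p.2) := by
  rcases area_map_eq_zero_or (F := Hil d) p.1 p.2 with h | ⟨q, hq, h⟩
  · simp [meanArea, h]
  · simp_rw [meanArea, h, ENNReal.ofReal_mul (area_nonneg p.1 p.2)]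
    rw [lintegral_const_mul _ (measurable_ofReal_area_map q), mul_comm]
    exact mul_le_mul_left (hr q hq) _

theorem meanArea_mconv_le [SFinite ν₁] [SFinite ν₂] {r : ℝ≥0∞}
    (hr : ∀ p ∈ orthoPairs (Hil d), meanArea ν₁ p ≤ r) (p : Hil d × Hil d) :
    meanArea (ν₁.mconv ν₂) p ≤ r * meanArea ν₂ p := by
  rw [meanArea, lintegral_mconv_swap _ _ (measurable_ofReal_area_map p), meanArea,
    ← lintegral_const_mul _ (measurable_ofReal_area_map p)]
  exact lintegral_mono fun v => meanArea_le_mul hr (v p.1, v p.2)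

/-- Dominated convergence: near `p` the integrand is at most `‖W‖²` times a constant. -/
theorem IsMeanIsometric.continuous_meanArea (h : IsMeanIsometric ν) :
    Continuous (meanArea ν) := by
  refine continuous_iff_continuousAt.mpr fun p => ?_
  have hC : ∀ᶠ q : Hil d × Hil d in nhds p, ‖q.1‖ * ‖q.2‖ < ‖p.1‖ * ‖p.2‖ + 1 := by
    have hc : Continuous fun q : Hil d × Hil d => ‖q.1‖ * ‖q.2‖ := by fun_prop
    exact hc.continuousAt.eventually_lt_const (lt_add_one _)
  refine tendsto_lintegral_filter_of_dominated_convergence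
    (fun W => ENNReal.ofReal (‖W‖ ^ 2 * (‖p.1‖ * ‖p.2‖ + 1)))
    (Filter.Eventually.of_forall measurable_ofReal_area_map) ?_ ?_ ?_
  · filter_upwards [hC] with q hq
    refine Filter.Eventually.of_forall fun W => ENNReal.ofReal_le_ofReal ?_
    calc area (W q.1) (W q.2) ≤ ‖W q.1‖ * ‖W q.2‖ := area_le _ _
      _ ≤ (‖W‖ * ‖q.1‖) * (‖W‖ * ‖q.2‖) :=
        mul_le_mul (W.le_opNorm _) (W.le_opNorm _) (norm_nonneg _) (by positivity)
      _ = ‖W‖ ^ 2 * (‖q.1‖ * ‖q.2‖) := by ring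
      _ ≤ _ := mul_le_mul_of_nonneg_left hq.le (by positivity)
  · exact ((h.integrable_norm_sq.mul_const _).lintegral_lt_top).ne
  · refine Filter.Eventually.of_forall fun W => ?_
    refine (ENNReal.continuous_ofReal.tendsto _).comp ?_
    have hc : Continuous fun q : Hil d × Hil d => area (W q.1) (W q.2) :=
      continuous_area.comp (f := fun q : Hil d × Hil d => (W q.1, W q.2)) (by fun_prop)
    exact hc.tendsto p

/-- In the case of equality, almost every operator is conformal on the span of the pair. -/
theorem IsMeanIsometric.ae_conformal (h : IsMeanIsometric ν) {p : Hil d × Hil d}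
    (hp : p ∈ orthoPairs (Hil d)) (h1 : 1 ≤ meanArea ν p) :
    ∀ᵐ W ∂ν, inner ℂ (W p.1) (W p.2) = 0 ∧ ‖W p.1‖ = ‖W p.2‖ := by
  have hm : Measurable fun W : Op d => ENNReal.ofReal ((‖W p.1‖ ^ 2 + ‖W p.2‖ ^ 2) / 2) := by
    have : Continuous fun W : Op d => (‖W p.1‖ ^ 2 + ‖W p.2‖ ^ 2) / 2 := by fun_prop
    exact this.measurable.ennreal_ofReal
  have := ae_eq_of_ae_le_of_lintegral_le
    (f := fun W : Op d => ENNReal.ofReal (area (W p.1) (W p.2)))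
    (g := fun W : Op d => ENNReal.ofReal ((‖W p.1‖ ^ 2 + ‖W p.2‖ ^ 2) / 2)) (μ := ν)
    (Filter.Eventually.of_forall fun W => ENNReal.ofReal_le_ofReal (area_le_half _ _))
    ((h.meanArea_le_one hp).trans_lt ENNReal.one_lt_top).ne hm.aemeasurable
    (by rw [h.lintegral_half_orthoPairs hp]; exact h1)
  filter_upwards [this] with W hW
  refine eq_of_area_eq ?_
  rwa [ENNReal.ofReal_eq_ofReal_iff (area_nonneg _ _) (by positivity)] at hW

/-- The orthogonal projector on the span of an orthonormal pair. -/
def pairProj (p : Hil d × Hil d) : Op d :=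
  InnerProductSpace.rankOne ℂ p.1 p.1 + InnerProductSpace.rankOne ℂ p.2 p.2

theorem pairProj_apply (p : Hil d × Hil d) (z : Hil d) :
    pairProj p z = (inner ℂ p.1 z) • p.1 + (inner ℂ p.2 z) • p.2 := rfl

theorem pairProj_apply_fst {p : Hil d × Hil d} (hp : p ∈ orthoPairs (Hil d)) :
    pairProj p p.1 = p.1 := by
  rw [pairProj_apply, inner_self_eq_norm_sq_to_K, hp.1, inner_eq_zero_symm.mp hp.2.2]
  simp

theorem pairProj_apply_snd {p : Hil d × Hil d} (hp : p ∈ orthoPairs (Hil d)) :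
    pairProj p p.2 = p.2 := by
  rw [pairProj_apply, inner_self_eq_norm_sq_to_K, hp.2.1, hp.2.2]
  simp

theorem isStarProjection_pairProj {p : Hil d × Hil d} (hp : p ∈ orthoPairs (Hil d)) :
    IsStarProjection (pairProj p) := by
  refine ⟨?_, ?_⟩
  · ext1 z
    change pairProj p (pairProj p z) = pairProj p z
    conv_lhs => rw [pairProj_apply p z, map_add, map_smul, map_smul, pairProj_apply_fst hp,
      pairProj_apply_snd hp]
    rfl
  · rw [ContinuousLinearMap.isSelfAdjoint_iff_isSymmetric]
    intro x y
    change inner ℂ (pairProj p x) y = inner ℂ x (pairProj p y)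
    simp only [pairProj_apply, inner_add_left, inner_add_right, inner_smul_left, inner_smul_right,
      inner_conj_symm]
    ring

theorem finrank_range_pairProj_ne_one {p : Hil d × Hil d} (hp : p ∈ orthoPairs (Hil d)) :
    Module.finrank ℂ (LinearMap.range (pairProj p).toLinearMap) ≠ 1 := by
  intro h
  obtain ⟨v, -, hv⟩ := finrank_eq_one_iff'.mp h
  obtain ⟨a, ha⟩ := hv ⟨p.1, p.1, pairProj_apply_fst hp⟩
  obtain ⟨b, hb⟩ := hv ⟨p.2, p.2, pairProj_apply_snd hp⟩
  have ha' : a • (v : Hil d) = p.1 := congrArg Subtype.val ha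
  have hb' : b • (v : Hil d) = p.2 := congrArg Subtype.val hb
  have h1 := area_of_mem_orthoPairs hp
  rw [← ha', ← hb', area_smul_smul] at h1
  have h0 : area (v : Hil d) (v : Hil d) = 0 := by
    simp [area, inner_self_eq_norm_sq_to_K]
    ring_nf
    simp
  rw [h0] at h1
  simp at h1

theorem pairProj_conformal {p : Hil d × Hil d} {W : Op d}
    (h : inner ℂ (W p.1) (W p.2) = 0 ∧ ‖W p.1‖ = ‖W p.2‖) :
    pairProj p * star W * W * pairProj p = (((‖W p.1‖ ^ 2 : ℝ)) : ℂ) • pairProj p := by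
  ext1 z
  change pairProj p ((star W * W) (pairProj p z)) = (((‖W p.1‖ ^ 2 : ℝ)) : ℂ) • pairProj p z
  have h' := inner_eq_zero_symm.mp h.1
  rw [pairProj_apply p ((star W * W) _), inner_star_mul_self, inner_star_mul_self,
    pairProj_apply p z, map_add, map_smul, map_smul, inner_add_right, inner_add_right,
    inner_smul_right, inner_smul_right, inner_smul_right, inner_smul_right, h.1, h',
    inner_self_eq_norm_sq_to_K, inner_self_eq_norm_sq_to_K, ← h.2]
  simp only [mul_zero, add_zero, zero_add, Complex.ofReal_pow, smul_add, smul_smul]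
  congr 2 <;> exact mul_comm _ _

variable {μ : Measure (Op d)} [SigmaFinite μ]

/-- Otherwise equality holds in the area bound for every `n`, almost every product is conformal on
the span of `p`, and `pairProj p` is a projector of rank other than one meeting the hypothesis of
(Pur). -/
theorem exists_meanArea_lt_one (hμ : IsMeanIsometric μ) (hPur : Pur μ) {p : Hil d × Hil d}
    (hp : p ∈ orthoPairs (Hil d)) : ∃ n, meanArea (prodLaw μ n) p < 1 := by
  by_contra! hcon
  refine finrank_range_pairProj_ne_one hp (hPur _ (isStarProjection_pairProj hp) ?_ fun n => ?_)
  · intro h0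
    have := pairProj_apply_fst hp
    rw [h0] at this
    have h1 := hp.1
    rw [← this] at h1
    simp at h1
  · have h := (hμ.prodLaw n).ae_conformal hp (hcon n)
    have h2 := ae_of_ae_map (measurable_prodOp n).aemeasurable h
    filter_upwards [h2] with v hv
    exact ⟨_, pairProj_conformal hv⟩

theorem antitone_meanArea_prodLaw (hμ : IsMeanIsometric μ) (p : Hil d × Hil d) :
    Antitone fun n => meanArea (prodLaw μ n) p := by
  intro m n hmn
  obtain ⟨k, rfl⟩ := Nat.exists_eq_add_of_le' hmn
  dsimp only
  rw [prodLaw_add]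
  simpa using meanArea_mconv_le (ν₁ := prodLaw μ k) (ν₂ := prodLaw μ m)
    (fun q hq => (hμ.prodLaw k).meanArea_le_one hq) p

/-- A Dini argument: the open sets where the mean area is below 1 increase with `n` and cover the
compact set of orthonormal pairs, so a single `n` suffices. The bound `r` is the maximum attained
there. -/
theorem exists_meanArea_le (hμ : IsMeanIsometric μ) (hPur : Pur μ) :
    ∃ n, ∃ r < 1, ∀ p ∈ orthoPairs (Hil d), meanArea (prodLaw μ n) p ≤ r := by
  have hK := isCompact_orthoPairs (E := Hil d)
  rcases (orthoPairs (Hil d)).eq_empty_or_nonempty with h0 | h0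
  · exact ⟨0, 0, one_pos, by simp [h0]⟩
  obtain ⟨n, hn⟩ : ∃ n, ∀ p ∈ orthoPairs (Hil d), meanArea (prodLaw μ n) p < 1 := by
    obtain ⟨t, ht⟩ := hK.elim_finite_subcover (fun n => {p | meanArea (prodLaw μ n) p < 1})
      (fun n => isOpen_lt (hμ.prodLaw n).continuous_meanArea continuous_const) (fun p hp => by
        simpa using exists_meanArea_lt_one hμ hPur hp)
    refine ⟨t.sup id, fun p hp => ?_⟩
    obtain ⟨n, hn, hlt⟩ : ∃ n ∈ t, meanArea (prodLaw μ n) p < 1 := by simpa using ht hp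
    exact (antitone_meanArea_prodLaw hμ p (Finset.le_sup (f := id) hn)).trans_lt hlt
  obtain ⟨q, hq, hmax⟩ := hK.exists_isMaxOn h0 (hμ.prodLaw n).continuous_meanArea.continuousOn
  exact ⟨n, _, hn q hq, hmax⟩

/-- The supremum of the mean area over orthonormal pairs is submultiplicative under convolution. -/
theorem exists_meanArea_le_pow (hμ : IsMeanIsometric μ) (hPur : Pur μ) :
    ∃ n, ∃ r < 1, ∀ k, ∀ p ∈ orthoPairs (Hil d), meanArea (prodLaw μ (k * n)) p ≤ r ^ k := by
  obtain ⟨n, r, hr, h⟩ := exists_meanArea_le hμ hPur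
  refine ⟨n, r, hr, fun k => ?_⟩
  induction k with
  | zero =>
    intro p hp
    rw [pow_zero]
    exact (hμ.prodLaw _).meanArea_le_one hp
  | succ k ih =>
    intro p hp
    rw [add_mul, one_mul, prodLaw_add, pow_succ]
    exact (meanArea_mconv_le ih p).trans (mul_le_mul_right (h p hp) _)

/-- Purification: the area contracts to zero in mean, uniformly. -/
theorem exists_meanArea_lt (hμ : IsMeanIsometric μ) (hPur : Pur μ) {ε : ℝ≥0∞} (hε : ε ≠ 0) :
    ∃ n, ∀ x y : Hil d, ‖x‖ = 1 → ‖y‖ = 1 → meanArea (prodLaw μ n) (x, y) ≤ ε := by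
  obtain ⟨n, r, hr, h⟩ := exists_meanArea_le_pow hμ hPur
  have ht := ENNReal.tendsto_pow_atTop_nhds_zero_of_lt_one hr
  obtain ⟨k, hk⟩ := (ht.eventually_lt_const (pos_iff_ne_zero.mpr hε)).exists
  refine ⟨k * n, fun x y hx hy => (meanArea_le_mul (h k) (x, y)).trans ?_⟩
  have h1 : ENNReal.ofReal (area x y) ≤ 1 := by
    rw [ENNReal.ofReal_le_one]
    simpa [hx, hy] using area_le x y
  calc r ^ k * ENNReal.ofReal (area x y) ≤ r ^ k * 1 := mul_le_mul_right h1 _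
    _ ≤ ε := by rw [mul_one]; exact hk.le

end MeanArea

/-! ### Continuous harmonic functions are quadratic forms -/

section Harmonic

/-- The mean value property `∫ f(W · x̂) ‖W x‖² dν(W) = f(x̂)`. -/
def IsMeanHarmonic (ν : Measure (Op d)) (f : Proj d → ℂ) : Prop :=
  ∀ x, ∫ W : Op d, (‖W (unitRep x)‖ ^ 2) • f (act W x) ∂ν = f x

theorem measurable_act_left (x : Proj d) : Measurable fun W : Op d => act W x :=
  measurable_act.comp measurable_prodMk_left

theorem IsHarmonic.isMeanHarmonic {μ : Measure (Op d)} [SFinite μ] {f : Proj d → ℂ}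
    (h : IsHarmonic μ f) : IsMeanHarmonic μ f := by
  intro x
  rw [← h.2 x]
  change _ = ∫ y, f y ∂((μ.withDensity fun v => ‖v (unitRep x)‖ₑ ^ 2).map fun v => act v x)
  rw [integral_map (measurable_act_left x).aemeasurable h.1.aestronglyMeasurable,
    integral_withDensity_eq_integral_toReal_smul (measurable_enorm_apply_const _)
      (Filter.Eventually.of_forall fun W => by simp)]
  simp

theorem exists_norm_le {f : Proj d → ℂ} (hf : Continuous f) : ∃ C, ∀ x, ‖f x‖ ≤ C := by
  obtain ⟨C, hC⟩ := (isCompact_univ (X := Proj d)).exists_bound_of_continuousOn hf.continuousOn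
  exact ⟨C, fun x => hC x (Set.mem_univ x)⟩

/-- Uniform continuity handles close points and boundedness the others. A bound affine in the
distance can be integrated against the area estimate. -/
theorem exists_dist_le {f : Proj d → ℂ} (hf : Continuous f) {ε : ℝ} (hε : 0 < ε) :
    ∃ C, 0 ≤ C ∧ ∀ x y, ‖f x - f y‖ ≤ ε + C * dist x y := by
  obtain ⟨B, hB⟩ := exists_norm_le hf
  obtain ⟨δ, hδ, h⟩ := Metric.uniformContinuous_iff.mp
    (CompactSpace.uniformContinuous_of_continuous hf) ε hε
  refine ⟨2 * |B| / δ, by positivity, fun x y => ?_⟩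
  rcases lt_or_ge (dist x y) δ with hxy | hxy
  · have h1 := h hxy
    rw [dist_eq_norm] at h1
    have : 0 ≤ 2 * |B| / δ * dist x y := by positivity
    linarith
  · have h1 : ‖f x - f y‖ ≤ 2 * |B| := by
      refine (norm_sub_le _ _).trans ?_
      linarith [hB x, hB y, le_abs_self B]
    have h2 : 2 * |B| ≤ 2 * |B| / δ * dist x y := by
      rw [div_mul_eq_mul_div, le_div_iff₀ hδ]
      exact mul_le_mul_of_nonneg_left hxy (by positivity)
    linarith

theorem measurable_norm_apply_unitRep_sq (x : Proj d) :
    Measurable fun W : Op d => ‖W (unitRep x)‖ ^ 2 := by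
  have : Continuous fun W : Op d => ‖W (unitRep x)‖ ^ 2 := by fun_prop
  exact this.measurable

theorem measurable_smul_act {f : Proj d → ℂ} (hf : Continuous f) (x : Proj d) :
    Measurable fun W : Op d => (‖W (unitRep x)‖ ^ 2) • f (act W x) :=
  (measurable_norm_apply_unitRep_sq x).smul (hf.measurable.comp (measurable_act_left x))

theorem IsMeanIsometric.integrable_smul {ν : Measure (Op d)} (hν : IsMeanIsometric ν)
    {f : Proj d → ℂ} (hf : Continuous f) (x : Proj d) :
    Integrable (fun W : Op d => (‖W (unitRep x)‖ ^ 2) • f (act W x)) ν := by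
  obtain ⟨C, hC⟩ := exists_norm_le hf
  refine ((hν.integrable_norm_apply_sq (unitRep x)).mul_const C).mono' ?_
    (Filter.Eventually.of_forall fun W => ?_)
  · exact (measurable_smul_act hf x).aestronglyMeasurable
  · rw [norm_smul, Real.norm_of_nonneg (by positivity)]
    exact mul_le_mul_of_nonneg_left (hC _) (by positivity)

theorem smul_act_mul (f : Proj d → ℂ) (W v : Op d) (x : Proj d) :
    (‖(W * v) (unitRep x)‖ ^ 2) • f (act (W * v) x) =
      (‖v (unitRep x)‖ ^ 2) • ((‖W (unitRep (act v x))‖ ^ 2) • f (act W (act v x))) := by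
  by_cases h : (W * v) (unitRep x) = 0
  · have h2 := norm_mul_apply_unitRep W v x
    rw [h, norm_zero, eq_comm, mul_eq_zero] at h2
    rcases h2 with h2 | h2 <;> simp [h, h2]
  · have h2 : v (unitRep x) ≠ 0 := by
      intro h0
      exact h (by simp [h0])
    rw [act_mul W v x h2 h, norm_mul_apply_unitRep, mul_pow, mul_smul]

/-- The Markov property, through the cocycle identity and Fubini; mean isometry of the convolution
supplies the joint integrability. -/
theorem IsMeanHarmonic.mconv {ν₁ ν₂ : Measure (Op d)} [SFinite ν₁] [SFinite ν₂]
    {f : Proj d → ℂ} (hf : Continuous f) (h : IsMeanIsometric (ν₁.mconv ν₂))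
    (h₁ : IsMeanHarmonic ν₁ f) (h₂ : IsMeanHarmonic ν₂ f) : IsMeanHarmonic (ν₁.mconv ν₂) f := by
  intro x
  have hi := h.integrable_smul hf x
  rw [Measure.mconv] at hi ⊢
  have hi2 : Integrable (fun p : Op d × Op d =>
      (‖(p.1 * p.2) (unitRep x)‖ ^ 2) • f (act (p.1 * p.2) x)) (ν₁.prod ν₂) :=
    hi.comp_measurable measurable_mul
  rw [integral_map measurable_mul.aemeasurable hi.aestronglyMeasurable,
    integral_prod_symm _ hi2, ← h₂ x]
  refine integral_congr_ae (Filter.Eventually.of_forall fun v => ?_)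
  simp only [smul_act_mul]
  rw [integral_smul, h₁]

theorem isMeanHarmonic_dirac_one (f : Proj d → ℂ) (hf : Continuous f) :
    IsMeanHarmonic (Measure.dirac (1 : Op d)) f := by
  intro x
  have h1 : act (1 : Op d) x = x := by
    rw [act, dif_pos (by simpa using unitRep_ne_zero x)]
    exact mk_unitRep x
  rw [integral_dirac' _ _ (measurable_smul_act hf x).stronglyMeasurable, h1,
    one_apply_eq_self, norm_unitRep]
  simp

theorem IsMeanHarmonic.prodLaw {μ : Measure (Op d)} [SigmaFinite μ] {f : Proj d → ℂ}
    (hf : Continuous f) (hμ : IsMeanIsometric μ) (h : IsMeanHarmonic μ f) (n : ℕ) :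
    IsMeanHarmonic (prodLaw μ n) f := by
  induction n with
  | zero => rw [prodLaw_zero]; exact isMeanHarmonic_dirac_one f hf
  | succ n ih =>
    have := hμ.prodLaw (n + 1)
    rw [prodLaw_succ] at this ⊢
    exact ih.mconv hf this h

/-- The lines spanned by the standard basis vectors. -/
def basisLine (i : Fin d) : Proj d :=
  Projectivization.mk ℂ (EuclideanSpace.basisFun (Fin d) ℂ i)
    ((EuclideanSpace.basisFun (Fin d) ℂ).toBasis.ne_zero i)

theorem norm_apply_basisLine (W : Op d) (i : Fin d) :
    ‖W (unitRep (basisLine i))‖ = ‖W (EuclideanSpace.basisFun (Fin d) ℂ i)‖ := by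
  have h := norm_apply_unitRep_mk W (EuclideanSpace.basisFun (Fin d) ℂ i)
    ((EuclideanSpace.basisFun (Fin d) ℂ).toBasis.ne_zero i)
  rwa [(EuclideanSpace.basisFun (Fin d) ℂ).norm_eq_one i, one_mul] at h

/-- The square of the Hilbert–Schmidt norm. -/
def hsSq (W : Op d) : ℝ := ∑ i, ‖W (unitRep (basisLine i))‖ ^ 2

theorem hsSq_nonneg (W : Op d) : 0 ≤ hsSq W := Finset.sum_nonneg fun i _ => by positivity

theorem norm_apply_unitRep_sq_le_hsSq (W : Op d) (x : Proj d) :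
    ‖W (unitRep x)‖ ^ 2 ≤ hsSq W := by
  have h := norm_apply_sq_le_sum W (unitRep x)
  rw [norm_unitRep, one_pow, one_mul] at h
  simpa [hsSq, norm_apply_basisLine] using h

/-- The mean of `f` over the images of the basis lines, weighted by the squares of the lengths. -/
def weightedMean (f : Proj d → ℂ) (W : Op d) : ℂ :=
  (hsSq W)⁻¹ • ∑ i, (‖W (unitRep (basisLine i))‖ ^ 2) • f (act W (basisLine i))

theorem measurable_weightedMean {f : Proj d → ℂ} (hf : Continuous f) :
    Measurable (weightedMean f) := by
  have h1 : Measurable (hsSq : Op d → ℝ) :=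
    Finset.measurable_fun_sum _ fun i _ => measurable_norm_apply_unitRep_sq _
  exact h1.inv.smul (Finset.measurable_fun_sum _ fun i _ => measurable_smul_act hf _)

theorem norm_weightedMean_le {f : Proj d → ℂ} {C : ℝ} (hC0 : 0 ≤ C) (hC : ∀ x, ‖f x‖ ≤ C)
    (W : Op d) : ‖weightedMean f W‖ ≤ C := by
  have h0 := hsSq_nonneg W
  rw [weightedMean, norm_smul, norm_inv, Real.norm_of_nonneg h0]
  have h1 : ‖∑ i, (‖W (unitRep (basisLine i))‖ ^ 2) • f (act W (basisLine i))‖ ≤ hsSq W * C := by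
    rw [hsSq, Finset.sum_mul]
    refine norm_sum_le_of_le _ fun i _ => ?_
    rw [norm_smul, Real.norm_of_nonneg (by positivity)]
    exact mul_le_mul_of_nonneg_left (hC _) (by positivity)
  rcases h0.eq_or_lt with h | h
  · rw [← h]
    simpa using hC0
  · rw [inv_mul_le_iff₀ h]
    exact h1

/-- With `S = ∑ w_i²`, both `u²` and `w_i²` are at most `S`, hence `u w_i ≤ S`. This trades the
weight `u² w_i² / S` for `w_i u`, the factor that turns projective distance into area. -/
theorem sq_mul_norm_smul_sum_sub_le {ι : Type*} [Fintype ι] {w : ι → ℝ} (hw : ∀ i, 0 ≤ w i)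
    {u : ℝ} (hu : 0 ≤ u) (huw : u ^ 2 ≤ ∑ i, w i ^ 2) (g : ι → ℂ) (z : ℂ) :
    u ^ 2 * ‖(∑ i, w i ^ 2)⁻¹ • ∑ i, (w i ^ 2) • g i - z‖ ≤ ∑ i, w i * u * ‖g i - z‖ := by
  have hws : ∀ i, w i ^ 2 ≤ ∑ i, w i ^ 2 := fun i =>
    Finset.single_le_sum (f := fun i => w i ^ 2) (fun i _ => sq_nonneg _) (Finset.mem_univ i)
  have hr : 0 ≤ ∑ i, w i * u * ‖g i - z‖ :=
    Finset.sum_nonneg fun i _ => mul_nonneg (mul_nonneg (hw i) hu) (norm_nonneg _)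
  have hS : ∑ i, (w i ^ 2) • (g i - z) = ∑ i, (w i ^ 2) • g i - (∑ i, w i ^ 2) • z := by
    rw [Finset.sum_smul, ← Finset.sum_sub_distrib]
    exact Finset.sum_congr rfl fun i _ => smul_sub _ _ _
  generalize (∑ i, w i ^ 2) = S at *
  rcases ((sq_nonneg u).trans huw).eq_or_lt with h | h
  · have h0 : u ^ 2 = 0 := le_antisymm (h ▸ huw) (sq_nonneg u)
    rw [h0, zero_mul]
    exact hr
  have h1 : S⁻¹ • ∑ i, (w i ^ 2) • g i - z = S⁻¹ • ∑ i, (w i ^ 2) • (g i - z) := by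
    rw [hS, smul_sub, smul_smul, inv_mul_cancel₀ h.ne', one_smul]
  rw [h1, norm_smul, norm_inv, Real.norm_of_nonneg h.le, ← mul_assoc, mul_comm (u ^ 2), mul_assoc,
    inv_mul_le_iff₀ h]
  refine (mul_le_mul_of_nonneg_left (norm_sum_le _ _) (sq_nonneg u)).trans ?_
  rw [Finset.mul_sum, Finset.mul_sum]
  refine Finset.sum_le_sum fun i _ => ?_
  rw [norm_smul, Real.norm_of_nonneg (sq_nonneg _)]
  have hwu : u * w i ≤ S := by
    have := two_mul_le_add_sq u (w i)
    have := hws i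
    linarith
  calc u ^ 2 * (w i ^ 2 * ‖g i - z‖) = (u * w i) * (w i * u * ‖g i - z‖) := by ring
    _ ≤ S * (w i * u * ‖g i - z‖) :=
      mul_le_mul_of_nonneg_right hwu (mul_nonneg (mul_nonneg (hw i) hu) (norm_nonneg _))

theorem norm_weightedMean_sub_le (f : Proj d → ℂ) (W : Op d) (x : Proj d) :
    ‖W (unitRep x)‖ ^ 2 * ‖weightedMean f W - f (act W x)‖ ≤
      ∑ i, ‖W (unitRep (basisLine i))‖ * ‖W (unitRep x)‖ *
        ‖f (act W (basisLine i)) - f (act W x)‖ :=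
  sq_mul_norm_smul_sum_sub_le (fun _ => norm_nonneg _) (norm_nonneg _)
    (norm_apply_unitRep_sq_le_hsSq W x) _ _

theorem norm_weightedMean_sub_le_area {f : Proj d → ℂ} {ε C : ℝ} (hε : 0 ≤ ε) (hC : 0 ≤ C)
    (h : ∀ x y, ‖f x - f y‖ ≤ ε + C * dist x y) (W : Op d) (x : Proj d) :
    ‖W (unitRep x)‖ ^ 2 * ‖weightedMean f W - f (act W x)‖ ≤
      ∑ i, (ε * ((‖W (unitRep (basisLine i))‖ ^ 2 + ‖W (unitRep x)‖ ^ 2) / 2) +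
        2 * C * area (W (unitRep (basisLine i))) (W (unitRep x))) := by
  refine (norm_weightedMean_sub_le f W x).trans (Finset.sum_le_sum fun i _ => ?_)
  set w := ‖W (unitRep (basisLine i))‖
  set u := ‖W (unitRep x)‖
  have h1 := two_mul_le_add_sq w u
  have h2 := mul_le_mul_of_nonneg_left (h (act W (basisLine i)) (act W x))
    (show 0 ≤ w * u by positivity)
  have h3 := mul_le_mul_of_nonneg_left (dist_act_mul_le W (basisLine i) x) hC
  have h4 : ε * (w * u) ≤ ε * ((w ^ 2 + u ^ 2) / 2) :=
    mul_le_mul_of_nonneg_left (by linarith) hε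
  linarith

theorem exists_quadForm_near {μ : Measure (Op d)} [SigmaFinite μ] (hμ : IsMeanIsometric μ)
    (hPur : Pur μ) {f : Proj d → ℂ} (hf : Continuous f) (h : IsMeanHarmonic μ f) {ε : ℝ}
    (hε : 0 < ε) : ∃ A : Op d, ∀ x, ‖quadForm (unitRep x) A - f x‖ ≤ ε := by
  -- Each of the `d` basis lines will contribute at most `ε₁ + 2 C δ ≤ 2 ε₁`; the `+ 1` here and in
  -- `δ` guards against `d = 0` and `C = 0`.
  set ε₁ : ℝ := ε / (2 * (d + 1)) with hε₁
  have hε₁0 : 0 < ε₁ := by positivity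
  obtain ⟨C, hC0, hC⟩ := exists_dist_le hf hε₁0
  obtain ⟨B, hB⟩ := exists_norm_le hf
  set δ : ℝ := ε₁ / (2 * C + 1) with hδ
  have hδ0 : 0 < δ := by positivity
  obtain ⟨n, hn⟩ := exists_meanArea_lt hμ hPur (ε := ENNReal.ofReal δ) (by simpa using hδ0)
  set ν := prodLaw μ n with hν
  have hνi : IsMeanIsometric ν := hμ.prodLaw n
  have hνh : IsMeanHarmonic ν f := h.prodLaw hf hμ n
  have hi : Integrable (fun W : Op d => weightedMean f W • (star W * W)) ν := by
    refine (hνi.integrable_norm_sq.const_mul |B|).mono' ?_ (Filter.Eventually.of_forall fun W => ?_)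
    · have hc : Continuous fun v : Op d => star v * v :=
        (ContinuousLinearMap.adjoint (𝕜 := ℂ) (E := Hil d) (F := Hil d)).continuous.mul
          continuous_id
      exact (measurable_weightedMean hf).aestronglyMeasurable.smul hc.aestronglyMeasurable
    · rw [norm_smul]
      refine mul_le_mul (norm_weightedMean_le (abs_nonneg B)
        (fun x => (hB x).trans (le_abs_self B)) W) ?_ (norm_nonneg _) (abs_nonneg _)
      rw [sq]
      exact (ContinuousLinearMap.norm_adjoint_comp_self W).le
  -- The form of this operator at `x` is the mean value integral of `f` with `f (act W x)` replaced
  -- by `weightedMean f W`.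
  refine ⟨∫ W, weightedMean f W • (star W * W) ∂ν, fun x => ?_⟩
  have hq : ∀ W : Op d, quadForm (unitRep x) (weightedMean f W • (star W * W)) =
      (‖W (unitRep x)‖ ^ 2) • weightedMean f W := by
    intro W
    rw [map_smul, quadForm_star_mul_self, smul_eq_mul, mul_comm, Complex.real_smul]
  have hi2 := (quadForm (unitRep x)).integrable_comp hi
  have h1 := (quadForm (unitRep x)).integral_comp_comm hi
  simp only [hq] at h1 hi2
  rw [← h1, ← hνh x, ← integral_sub hi2 (hνi.integrable_smul hf x)]
  simp only [← smul_sub]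
  have hle : ‖∫ W : Op d, (‖W (unitRep x)‖ ^ 2) • (weightedMean f W - f (act W x)) ∂ν‖ₑ ≤
      ENNReal.ofReal ε := by
    refine (enorm_integral_le_lintegral_enorm _).trans ?_
    have hpt : ∀ W : Op d, ‖(‖W (unitRep x)‖ ^ 2) • (weightedMean f W - f (act W x))‖ₑ ≤
        ∑ i, (ENNReal.ofReal ε₁ * ENNReal.ofReal
            ((‖W (unitRep (basisLine i))‖ ^ 2 + ‖W (unitRep x)‖ ^ 2) / 2) +
          ENNReal.ofReal (2 * C) *
            ENNReal.ofReal (area (W (unitRep (basisLine i))) (W (unitRep x)))) := by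
      intro W
      rw [← ofReal_norm, norm_smul, Real.norm_of_nonneg (by positivity)]
      refine (ENNReal.ofReal_le_ofReal
        (norm_weightedMean_sub_le_area hε₁0.le hC0 hC W x)).trans_eq ?_
      rw [ENNReal.ofReal_sum_of_nonneg fun i _ => add_nonneg (by positivity)
        (mul_nonneg (by positivity) (area_nonneg _ _))]
      refine Finset.sum_congr rfl fun i _ => ?_
      rw [ENNReal.ofReal_add (by positivity) (mul_nonneg (by positivity) (area_nonneg _ _)),
        ENNReal.ofReal_mul hε₁0.le, ENNReal.ofReal_mul (by positivity)]
    refine (lintegral_mono hpt).trans ?_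
    have hm1 : ∀ i, Measurable fun W : Op d => ENNReal.ofReal
        ((‖W (unitRep (basisLine i))‖ ^ 2 + ‖W (unitRep x)‖ ^ 2) / 2) := fun i =>
      (((measurable_norm_apply_unitRep_sq _).add
        (measurable_norm_apply_unitRep_sq x)).div_const 2).ennreal_ofReal
    have hm2 : ∀ i : Fin d, Measurable fun W : Op d =>
        ENNReal.ofReal (area (W (unitRep (basisLine i))) (W (unitRep x))) := fun i =>
      measurable_ofReal_area_map (unitRep (basisLine i), unitRep x)
    have hm3 : ∀ i : Fin d, Measurable fun W : Op d => ENNReal.ofReal ε₁ * ENNReal.ofReal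
            ((‖W (unitRep (basisLine i))‖ ^ 2 + ‖W (unitRep x)‖ ^ 2) / 2) +
          ENNReal.ofReal (2 * C) *
            ENNReal.ofReal (area (W (unitRep (basisLine i))) (W (unitRep x))) := fun i =>
      ((hm1 i).const_mul _).add ((hm2 i).const_mul _)
    rw [lintegral_finsetSum _ fun i _ => hm3 i]
    calc _ ≤ ∑ _i : Fin d, ENNReal.ofReal (ε₁ + 2 * C * δ) := by
          refine Finset.sum_le_sum fun i _ => ?_
          rw [lintegral_add_left ((hm1 i).const_mul _), lintegral_const_mul _ (hm1 i),
            lintegral_const_mul _ (hm2 i), hνi.lintegral_half, norm_unitRep, norm_unitRep,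
            ENNReal.ofReal_add hε₁0.le (by positivity), ENNReal.ofReal_mul (p := 2 * C)
              (by positivity)]
          refine add_le_add (by norm_num) (mul_le_mul_right ?_ _)
          exact hn _ _ (norm_unitRep _) (norm_unitRep _)
      _ = ENNReal.ofReal (d * (ε₁ + 2 * C * δ)) := by
          rw [Finset.sum_const, Finset.card_univ, Fintype.card_fin, nsmul_eq_mul,
            ENNReal.ofReal_mul (Nat.cast_nonneg d), ENNReal.ofReal_natCast]
      _ ≤ ENNReal.ofReal ε := by
          refine ENNReal.ofReal_le_ofReal ?_
          have h2 : 2 * C * δ ≤ ε₁ := by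
            rw [hδ, mul_div_assoc', div_le_iff₀ (by positivity)]
            nlinarith
          have h3 : (d + 1) * (2 * ε₁) = ε := by
            rw [hε₁]
            field_simp
          have h4 : (d : ℝ) * (ε₁ + 2 * C * δ) ≤ d * (2 * ε₁) :=
            mul_le_mul_of_nonneg_left (by linarith) (Nat.cast_nonneg d)
          linarith
  rw [← ofReal_norm] at hle
  exact (ENNReal.ofReal_le_ofReal_iff hε.le).mp hle

/-- Continuous harmonic functions are quadratic forms. -/
theorem exists_eq_quadForm {μ : Measure (Op d)} [SigmaFinite μ] (hμ : IsMeanIsometric μ)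
    (hPur : Pur μ) {f : Proj d → ℂ} (hf : Continuous f) (h : IsMeanHarmonic μ f) :
    ∃ A : Op d, ∀ x, f x = quadForm (unitRep x) A := by
  set L : Op d →ₗ[ℂ] (Proj d → ℂ) :=
    LinearMap.pi fun x => (quadForm (unitRep x)).toLinearMap with hL
  -- The range is finite-dimensional, hence closed for pointwise convergence, so the approximating
  -- operators need not converge.
  have hclosed : IsClosed (LinearMap.range L : Set (Proj d → ℂ)) :=
    Submodule.closed_of_finiteDimensional _
  choose A hA using fun n : ℕ => exists_quadForm_near hμ hPur hf h
    (show (0 : ℝ) < 1 / ((n : ℝ) + 1) by positivity)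
  have ht : Filter.Tendsto (fun n => L (A n)) Filter.atTop (nhds f) := by
    refine tendsto_pi_nhds.mpr fun x => ?_
    rw [tendsto_iff_norm_sub_tendsto_zero]
    exact squeeze_zero (fun _ => norm_nonneg _) (fun n => hA n x)
      tendsto_one_div_add_atTop_nhds_zero_nat
  obtain ⟨T, hT⟩ := hclosed.mem_of_tendsto ht
    (Filter.Eventually.of_forall fun n => LinearMap.mem_range_self L (A n))
  exact ⟨T, fun x => (congrFun hT x).symm⟩

end Harmonic

/-! ### Maximum principle and the minimal invariant subspace -/

section Ergodic

/-- If `T x ≠ 0`, the form is negative at `x + t T x` for small `t < 0`, since its expansion starts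
with `2 t ‖T x‖²`. -/
theorem eq_zero_of_quadForm_re_eq_zero {T : Op d} (hT : T.IsSymmetric)
    (hpos : ∀ x, 0 ≤ (quadForm x T).re) {x : Hil d} (hx : (quadForm x T).re = 0) : T x = 0 := by
  have hexp : ∀ t : ℝ, (quadForm (x + (t : ℂ) • T x) T).re =
      2 * t * ‖T x‖ ^ 2 + t ^ 2 * (quadForm (T x) T).re := by
    intro t
    have h1 : inner ℂ x (T (T x)) = inner ℂ (T x) (T x) := (hT x (T x)).symm
    have h2 : (inner ℂ (T x) (T x)).re = ‖T x‖ ^ 2 := inner_self_eq_norm_sq (𝕜 := ℂ) (T x)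
    simp only [quadForm_apply] at hx ⊢
    rw [map_add, map_smul, inner_add_left, inner_add_right, inner_add_right, inner_smul_left,
      inner_smul_left, inner_smul_right, inner_smul_right, h1]
    simp only [Complex.add_re, Complex.conj_ofReal, Complex.re_ofReal_mul, hx, h2]
    ring
  by_contra h0
  have hn : 0 < ‖T x‖ ^ 2 := by positivity
  have hK := hpos (T x)
  set K := (quadForm (T x) T).re
  -- Nearly the minimiser `t = -‖T x‖² / K`; the `+ 1` allows `K = 0`.
  have h := hpos (x + ((-(‖T x‖ ^ 2 / (K + 1)) : ℝ) : ℂ) • T x)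
  rw [hexp] at h
  have h3 : 2 * -(‖T x‖ ^ 2 / (K + 1)) * ‖T x‖ ^ 2 + (-(‖T x‖ ^ 2 / (K + 1))) ^ 2 * K =
      -((‖T x‖ ^ 2) ^ 2 * (K + 2) / (K + 1) ^ 2) := by
    field_simp
    ring
  rw [h3] at h
  have : 0 < (‖T x‖ ^ 2) ^ 2 * (K + 2) / (K + 1) ^ 2 := by positivity
  linarith

theorem continuous_quadForm_map (x : Hil d) (T : Op d) :
    Continuous fun v : Op d => quadForm (v x) T := by
  simp only [quadForm_apply]
  fun_prop

theorem IsMeanIsometric.integrable_quadForm {ν : Measure (Op d)} (h : IsMeanIsometric ν)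
    (x : Hil d) (T : Op d) : Integrable (fun v : Op d => quadForm (v x) T) ν := by
  refine ((h.integrable_norm_apply_sq x).const_mul ‖T‖).mono'
    (continuous_quadForm_map x T).aestronglyMeasurable (Filter.Eventually.of_forall fun v => ?_)
  calc ‖quadForm (v x) T‖ ≤ ‖v x‖ * ‖T (v x)‖ := norm_inner_le_norm (v x) (T (v x))
    _ ≤ ‖v x‖ * (‖T‖ * ‖v x‖) := mul_le_mul_of_nonneg_left (T.le_opNorm _) (norm_nonneg _)
    _ = ‖T‖ * ‖v x‖ ^ 2 := by ring

/-- A nonnegative function with zero integral vanishes almost everywhere; the condition `T (v x) =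
0` is closed in `v`, so it passes to the whole support. -/
theorem apply_mem_ker_of_integral_quadForm {μ : Measure (Op d)} (hμ : IsMeanIsometric μ)
    {T : Op d} (hT : T.IsSymmetric) (hpos : ∀ x, 0 ≤ (quadForm x T).re)
    (hint : ∀ x, ∫ v : Op d, (quadForm (v x) T).re ∂μ = (quadForm x T).re)
    {v : Op d} (hv : v ∈ μ.support) {x : Hil d} (hx : T x = 0) : T (v x) = 0 := by
  have h0 : (quadForm x T).re = 0 := by simp [hx]
  have h1 := hint x
  have hi : Integrable (fun v : Op d => (quadForm (v x) T).re) μ :=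
    (hμ.integrable_quadForm x T).re
  have hnn : 0 ≤ᵐ[μ] fun v : Op d => (quadForm (v x) T).re :=
    Filter.Eventually.of_forall fun v => hpos (v x)
  have h2 : (fun v : Op d => (quadForm (v x) T).re) =ᵐ[μ] 0 :=
    (integral_eq_zero_iff_of_nonneg_ae hnn hi).mp (h1.trans h0)
  have hc : IsClosed {v : Op d | T (v x) = 0} := isClosed_eq (by fun_prop) continuous_const
  have h3 : ∀ᵐ w ∂μ, T (w x) = 0 := by
    filter_upwards [h2] with w hw
    exact eq_zero_of_quadForm_re_eq_zero hT hpos hw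
  exact Measure.support_subset_of_isClosed hc h3 hv

/-- The self-adjoint part of an operator. -/
def symPart (A : Op d) : Op d := (2⁻¹ : ℂ) • (A + ContinuousLinearMap.adjoint A)

theorem isSymmetric_symPart (A : Op d) : (symPart A).IsSymmetric := by
  intro x y
  change inner ℂ (symPart A x) y = inner ℂ x (symPart A y)
  simp only [symPart, _root_.smul_apply, _root_.add_apply, inner_smul_left, inner_smul_right,
    inner_add_left, inner_add_right, ContinuousLinearMap.adjoint_inner_left,
    ContinuousLinearMap.adjoint_inner_right, map_inv₀, map_ofNat]
  rw [add_comm]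

theorem symPart_neg (A : Op d) : symPart (-A) = -symPart A := by
  rw [symPart, symPart, map_neg, ← neg_add, smul_neg]

theorem quadForm_symPart_re (A : Op d) (x : Hil d) :
    (quadForm x (symPart A)).re = (quadForm x A).re := by
  have h : quadForm x (ContinuousLinearMap.adjoint A) = (starRingEnd ℂ) (quadForm x A) := by
    simp [ContinuousLinearMap.adjoint_inner_right]
  rw [symPart, map_smul, map_add, h, Complex.add_conj, smul_eq_mul]
  simp

theorem quadForm_one (x : Hil d) : quadForm x (1 : Op d) = ((‖x‖ ^ 2 : ℝ) : ℂ) := by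
  rw [quadForm_apply, one_apply_eq_self, inner_self_eq_norm_sq_to_K]
  push_cast
  rfl

/-- If `A` is harmonic and its real part is bounded by `M`, a bound which is attained, then the
minimal invariant subspace consists of eigenvectors of the real part of `A`. -/
theorem symPart_apply_of_mem_minimal {μ : Measure (Op d)} (hμ : IsMeanIsometric μ) (hErg : Erg μ)
    {E : Submodule ℂ (Hil d)} (hE : Minimal (IsInvariantSubspace μ) E) {A : Op d}
    (hA : ∀ x, ∫ v : Op d, quadForm (v x) A ∂μ = quadForm x A) {M : ℝ}
    (hM : ∀ x, (quadForm x A).re ≤ M * ‖x‖ ^ 2) {u : Hil d} (hu : u ≠ 0)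
    (huM : (quadForm u A).re = M * ‖u‖ ^ 2) {x : Hil d} (hx : x ∈ E) :
    symPart A x = (M : ℂ) • x := by
  set T : Op d := (M : ℂ) • 1 - symPart A with hTdef
  have hT : T.IsSymmetric := by
    intro y z
    have h := isSymmetric_symPart A y z
    change inner ℂ ((M : ℂ) • y - symPart A y) z = inner ℂ y ((M : ℂ) • z - symPart A z)
    change inner ℂ (symPart A y) z = inner ℂ y (symPart A z) at h
    rw [inner_sub_left, inner_sub_right, h, inner_smul_left, inner_smul_right, Complex.conj_ofReal]
  have hq : ∀ y, (quadForm y T).re = M * ‖y‖ ^ 2 - (quadForm y A).re := by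
    intro y
    rw [hTdef, map_sub, map_smul, quadForm_one, Complex.sub_re, quadForm_symPart_re, smul_eq_mul,
      ← Complex.ofReal_mul, Complex.ofReal_re]
  have hpos : ∀ y, 0 ≤ (quadForm y T).re := fun y => by
    rw [hq]
    exact sub_nonneg.mpr (hM y)
  have hiso : ∀ y : Hil d, ∫ v : Op d, ‖v y‖ ^ 2 ∂μ = ‖y‖ ^ 2 := by
    intro y
    have h := hμ y
    simp_rw [enorm_sq_eq_ofReal] at h
    rw [integral_eq_lintegral_of_nonneg_ae (Filter.Eventually.of_forall fun v => by positivity)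
      (hμ.integrable_norm_apply_sq y).aestronglyMeasurable, h,
      ENNReal.toReal_ofReal (by positivity)]
  have hint : ∀ y, ∫ v : Op d, (quadForm (v y) T).re ∂μ = (quadForm y T).re := by
    intro y
    simp_rw [hq]
    have hre : ∫ v : Op d, (quadForm (v y) A).re ∂μ = (quadForm y A).re := by
      rw [← hA y]
      exact integral_re (hμ.integrable_quadForm y A)
    have hi : Integrable (fun v : Op d => (quadForm (v y) A).re) μ :=
      (hμ.integrable_quadForm y A).re
    rw [integral_sub ((hμ.integrable_norm_apply_sq y).const_mul M) hi, integral_const_mul, hiso, hre]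
  have hker : IsInvariantSubspace μ (LinearMap.ker T.toLinearMap) := by
    refine ⟨?_, fun v hv y hy => ?_⟩
    · refine (Submodule.ne_bot_iff _).mpr ⟨u, ?_, hu⟩
      exact eq_zero_of_quadForm_re_eq_zero hT hpos (by rw [hq, huM, sub_self])
    · exact apply_mem_ker_of_integral_quadForm hμ hT hpos hint hv hy
  -- Finite dimension puts a minimal invariant subspace inside the kernel, and uniqueness identifies
  -- it with `E`.
  obtain ⟨F, hF, hFm⟩ := exists_minimal_le_of_wellFoundedLT _ _ hker
  rw [hErg.unique hFm hE] at hF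
  have h := hF hx
  have h2 : (M : ℂ) • x - symPart A x = 0 := h
  exact (sub_eq_zero.mp h2).symm

theorem quadForm_smul (c : ℂ) (x : Hil d) (T : Op d) :
    quadForm (c • x) T = ((‖c‖ ^ 2 : ℝ) : ℂ) * quadForm x T := by
  rw [quadForm_apply, quadForm_apply, map_smul, inner_smul_left, inner_smul_right, ← mul_assoc,
    Complex.conj_mul']
  push_cast
  rfl

theorem quadForm_eq_mul_unitRep (w : Hil d) (hw : w ≠ 0) (T : Op d) :
    quadForm w T = ((‖w‖ ^ 2 : ℝ) : ℂ) * quadForm (unitRep (Projectivization.mk ℂ w hw)) T := by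
  obtain ⟨c, hc⟩ := (Projectivization.mk_eq_mk_iff' ℂ _ _ hw (unitRep_ne_zero _)).mp
    (mk_unitRep (Projectivization.mk ℂ w hw)).symm
  have hn : ‖w‖ = ‖c‖ := by
    conv_lhs => rw [← hc, norm_smul, norm_unitRep, mul_one]
  rw [hn, ← quadForm_smul, hc]

theorem quadForm_apply_unitRep (v : Op d) (x : Proj d) (T : Op d) :
    quadForm (v (unitRep x)) T =
      (‖v (unitRep x)‖ ^ 2) • quadForm (unitRep (act v x)) T := by
  by_cases h : v (unitRep x) = 0
  · simp [h]
  · rw [act, dif_pos h, quadForm_eq_mul_unitRep _ h, Complex.real_smul]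

theorem IsMeanHarmonic.integral_quadForm {μ : Measure (Op d)} {f : Proj d → ℂ}
    (h : IsMeanHarmonic μ f) {A : Op d} (hA : ∀ x, f x = quadForm (unitRep x) A) (x : Hil d) :
    ∫ v : Op d, quadForm (v x) A ∂μ = quadForm x A := by
  by_cases hx : x = 0
  · simp [hx]
  obtain ⟨c, hc⟩ := (Projectivization.mk_eq_mk_iff' ℂ _ _ hx (unitRep_ne_zero _)).mp
    (mk_unitRep (Projectivization.mk ℂ x hx)).symm
  have h1 := h (Projectivization.mk ℂ x hx)
  simp only [hA, ← quadForm_apply_unitRep] at h1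
  rw [← hc, quadForm_smul, ← h1, ← integral_const_mul]
  refine integral_congr_ae (Filter.Eventually.of_forall fun v => ?_)
  simp only [map_smul, quadForm_smul]

theorem exists_re_eq_const {μ : Measure (Op d)} (hμ : IsMeanIsometric μ) (hErg : Erg μ)
    {f : Proj d → ℂ} (hf : Continuous f) (h : IsMeanHarmonic μ f) {A : Op d}
    (hA : ∀ x, f x = quadForm (unitRep x) A) : ∃ c : ℝ, ∀ x, (f x).re = c := by
  rcases isEmpty_or_nonempty (Proj d) with he | he
  · exact ⟨0, fun x => he.elim x⟩
  have hre : Continuous fun x => (f x).re := Complex.continuous_re.comp hf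
  obtain ⟨xM, -, hxM⟩ := (isCompact_univ (X := Proj d)).exists_isMaxOn Set.univ_nonempty
    hre.continuousOn
  obtain ⟨xm, -, hxm⟩ := (isCompact_univ (X := Proj d)).exists_isMinOn Set.univ_nonempty
    hre.continuousOn
  have hq : ∀ (w : Hil d) (hw : w ≠ 0), (quadForm w A).re =
      ‖w‖ ^ 2 * (f (Projectivization.mk ℂ w hw)).re := by
    intro w hw
    rw [quadForm_eq_mul_unitRep w hw, ← hA, Complex.re_ofReal_mul]
  obtain ⟨E, hE⟩ := hErg.exists
  obtain ⟨w, hwE, hw0⟩ := (Submodule.ne_bot_iff E).mp hE.1.1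
  have hint := h.integral_quadForm hA
  have h1 : symPart A w = (((f xM).re : ℝ) : ℂ) • w := by
    refine symPart_apply_of_mem_minimal hμ hErg hE hint (fun y => ?_) (unitRep_ne_zero xM) ?_ hwE
    · by_cases hy : y = 0
      · simp [hy]
      · rw [hq y hy, mul_comm]
        exact mul_le_mul_of_nonneg_right (hxM (Set.mem_univ _)) (by positivity)
    · rw [← hA, norm_unitRep]
      ring
  -- The minimum of the real part is the maximum for `-A`; the same `w ∈ E` is then an eigenvector
  -- for both extreme values.
  have h2 : symPart (-A) w = ((-(f xm).re : ℝ) : ℂ) • w := by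
    refine symPart_apply_of_mem_minimal hμ hErg hE (fun y => ?_) (fun y => ?_) (unitRep_ne_zero xm) ?_ hwE
    · simp_rw [map_neg]
      rw [integral_neg, hint]
    · rw [map_neg, Complex.neg_re, neg_mul]
      refine neg_le_neg ?_
      by_cases hy : y = 0
      · simp [hy]
      · rw [hq y hy, mul_comm]
        exact mul_le_mul_of_nonneg_left (hxm (Set.mem_univ _)) (by positivity)
    · rw [map_neg, ← hA, norm_unitRep, Complex.neg_re]
      ring
  have h3 : (f xM).re = (f xm).re := by
    rw [symPart_neg, _root_.neg_apply, h1, ← neg_smul] at h2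
    have := smul_left_injective ℂ hw0 h2
    rw [← Complex.ofReal_neg, Complex.ofReal_inj] at this
    linarith
  refine ⟨(f xM).re, fun x => le_antisymm (hxM (Set.mem_univ x)) ?_⟩
  rw [h3]
  exact hxm (Set.mem_univ x)

end Ergodic

end QuantumTrajectory

end

theorem proposition3p2 (d : ℕ) (μ : MeasureTheory.Measure (QuantumTrajectory.Op d))
    [MeasureTheory.SigmaFinite μ] (hμ : QuantumTrajectory.IsStochastic μ)
    (hErg : QuantumTrajectory.Erg μ) (hPur : QuantumTrajectory.Pur μ)
    (f : QuantumTrajectory.Proj d → ℂ) (hf : Continuous f)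
    (hharm : QuantumTrajectory.IsHarmonic μ f) :
    ∃ c : ℂ, ∀ x : QuantumTrajectory.Proj d, f x = c := by
  have hiso := hμ.isMeanIsometric
  have h := hharm.isMeanHarmonic
  obtain ⟨A, hA⟩ := QuantumTrajectory.exists_eq_quadForm hiso hPur hf h
  obtain ⟨a, ha⟩ := QuantumTrajectory.exists_re_eq_const hiso hErg hf h hA
  -- The real part of `-i f` is the imaginary part of `f`, and its quadratic form is that of `-i A`.
  have h' : QuantumTrajectory.IsMeanHarmonic μ fun x => -Complex.I * f x := by
    intro x
    simp_rw [← mul_smul_comm]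
    rw [MeasureTheory.integral_const_mul, h x]
  obtain ⟨b, hb⟩ := QuantumTrajectory.exists_re_eq_const hiso hErg
    (f := fun x => -Complex.I * f x) (continuous_const.mul hf) h' (A := -Complex.I • A)
    (fun x => by rw [map_smul, hA, smul_eq_mul])
  refine ⟨⟨a, b⟩, fun x => Complex.ext (ha x) ?_⟩
  simpa using hb x
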